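/- **Setting.** Let $\mathcal{A}$ be a von Neumann algebra, $\mathcal{B}\subset\mathcal{A}$ a von Neumann subalgebra, $\mathsf{E}:\mathcal{A}\to\mathcal{B}$ a normal faithful conditional expectation, and let $\mathsf{A}_1,\mathsf{A}_2,\ldots$ be von Neumann subalgebras of $\mathcal{A}$ containing $\mathcal{B}$, such that $\mathcal{A}$ is the reduced amalgamated free product $*_{\mathcal{B}}\mathsf{A}_k$ with respect to $\mathsf{E}$: the $\mathsf{A}_k$ generate $\mathcal{A}$ as a von Neumann algebra, and they are freely independent over $\mathsf{E}$, i.e. $\mathsf{E}(a_1a_2\cdots a_m)=0$ whenever $m\ge 1$, $a_i\in\mathsf{A}_{j_i}$, $\mathsf{E}(a_i)=0$ and $j_1\neq j_2\neq\cdots\neq j_m$ (consecutive indices are distinct). For $\mathcal{B}=\mathbb{C}1$ this is the reduced free product of von Neumann algebras with respect to normal faithful states. A product $a_1\cdots a_m$ as above (with $m \ge 1$) is a *reduced word* of length $m$. A *free polynomial of degree at most $d$* is an element of the norm closure in $\mathcal{A}$ of the linear span of $\mathcal{B}$ and the reduced words of length at most $d$. Let $\mathcal{A}_n$ be the von Neumann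 algebra generated by $\mathsf{A}_1,\ldots,\mathsf{A}_n$ and let $\mathsf{E}_n:\mathcal{A}\to\mathcal{A}_n$ be the normal faithful conditional expectation with $\mathsf{E}\circ\mathsf{E}_n=\mathsf{E}$, so that $\mathsf{E}_n(z)$ is the unique $y\in\mathcal{A}_n$ with $\mathsf{E}(ay)=\mathsf{E}(az)$ for all $a\in\mathcal{A}_n$. A *free martingale* is a sequence $x=(x_n)_{n\ge1}$ with $x_n\in\mathcal{A}_n$ and $\mathsf{E}_n(x_{n+1})=x_n$ for all $n\ge1$; its differences are $dx_1=x_1$ and $dx_k=x_k-x_{k-1}$ for $k\ge2$. It is called *$d$-polynomial* if every $dx_k$ is a free polynomial of degree at most $d$. **Proposition.** There is an absolute constant $c>0$ such that for all $\mathcal{A},\mathcal{B},\mathsf{E},(\mathsf{A}_k)$ as above, every integer $d\ge1$, every $d$-polynomial free martingale $x$ and every $n$, $$\Big\|\sum_{k=1}^n dx_k\Big\|_\infty\le c^d\,d^2\sqrt{d!}\;\max\Big\{\Big\|\Big(\sum_{k=1}^n dx_k\,dx_k^*\Big)^{1/2}\Big\|_\infty,\ \Big\|\Big(\sum_{k=1}^n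 dx_k^*\,dx_k\Big)^{1/2}\Big\|_\infty\Big\},$$ where $\|\cdot\|_\infty$ is the operator norm of $\mathcal{A}$. -/

import Mathlib

universe u

section FreeMartingales

variable {H : Type u} [NormedAddCommGroup H] [InnerProductSpace ℂ H] [CompleteSpace H]

/-- The von Neumann algebra on `H` generated by a set of bounded operators: the bicommutant of
`S ∪ S*`. -/
noncomputable def vnGenerated (S : Set (H →L[ℂ] H)) : VonNeumannAlgebra H where
  toStarSubalgebra :=
    StarSubalgebra.centralizer ℂ ((StarSubalgebra.centralizer ℂ S : Set (H →L[ℂ] H)))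
  centralizer_centralizer' := by
    change Set.centralizer (Set.centralizer
      ((StarSubalgebra.centralizer ℂ ((StarSubalgebra.centralizer ℂ S : Set (H →L[ℂ] H)))
        : StarSubalgebra ℂ (H →L[ℂ] H)) : Set (H →L[ℂ] H))) =
      ((StarSubalgebra.centralizer ℂ ((StarSubalgebra.centralizer ℂ S : Set (H →L[ℂ] H)))
        : StarSubalgebra ℂ (H →L[ℂ] H)) : Set (H →L[ℂ] H))
    simp only [StarSubalgebra.coe_centralizer]
    exact Set.centralizer_centralizer_centralizer _

/-- `E` is a normal faithful conditional expectation from the von Neumann algebra `M` onto its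
von Neumann subalgebra `N`: a positive `N`-bimodule projection of `M` onto `N` which is faithful
and preserves suprema of bounded increasing nets of self-adjoint operators. -/
structure IsNormalFaithfulCondExp (M N : VonNeumannAlgebra H)
    (E : M.toStarSubalgebra →ₗ[ℂ] N.toStarSubalgebra) : Prop where
  le : N ≤ M
  apply_of_mem : ∀ a : M.toStarSubalgebra, (a : H →L[ℂ] H) ∈ N →
    (E a : H →L[ℂ] H) = (a : H →L[ℂ] H)
  nonneg : ∀ a : M.toStarSubalgebra, 0 ≤ (E (star a * a) : H →L[ℂ] H)
  bimodule : ∀ b a c : M.toStarSubalgebra, (b : H →L[ℂ] H) ∈ N → (c : H →L[ℂ] H) ∈ N →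
    (E (b * a * c) : H →L[ℂ] H) = (b : H →L[ℂ] H) * (E a : H →L[ℂ] H) * (c : H →L[ℂ] H)
  faithful : ∀ a : M.toStarSubalgebra, E (star a * a) = 0 → a = 0
  normal : ∀ D : Set M.toStarSubalgebra, D.Nonempty → (∀ a ∈ D, IsSelfAdjoint a) →
    DirectedOn (fun a b : M.toStarSubalgebra => (a : H →L[ℂ] H) ≤ (b : H →L[ℂ] H)) D →
    ∀ s : M.toStarSubalgebra,
      IsLUB ((fun a : M.toStarSubalgebra => (a : H →L[ℂ] H)) '' D) (s : H →L[ℂ] H) →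
      IsLUB ((fun a : M.toStarSubalgebra => (E a : H →L[ℂ] H)) '' D) (E s : H →L[ℂ] H)

/-- A reduced word `[(j₁, a₁), …, (j_m, a_m)]`: consecutive indices are distinct and each `a_i` is
a mean-zero letter of the algebra with index `j_i`, that is, `a_i ∈ A j_i` and `E a_i = 0`. -/
structure IsReducedWord {M N : VonNeumannAlgebra H} (A : ℕ → VonNeumannAlgebra H)
    (E : M.toStarSubalgebra →ₗ[ℂ] N.toStarSubalgebra)
    (w : List (ℕ × M.toStarSubalgebra)) : Prop where
  isChain : (w.map Prod.fst).IsChain (· ≠ ·)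
  mem : ∀ p ∈ w, (p.2 : H →L[ℂ] H) ∈ A p.1
  meanZero : ∀ p ∈ w, E p.2 = 0

/-- The operator obtained by multiplying the letters of a word. -/
noncomputable def wordProd {M : VonNeumannAlgebra H} (w : List (ℕ × M.toStarSubalgebra)) :
    M.toStarSubalgebra :=
  (w.map Prod.snd).prod

/-- `(M, E)` is the reduced amalgamated free product of the von Neumann algebras `A 0, A 1, …` over
their common subalgebra `N`: `E : M → N` is a normal faithful conditional expectation, the algebras
`A k` contain `N`, they generate `M`, and they are freely independent over `E`. The free product
over scalars is the case in which `N` consists of the multiples of the identity. -/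
structure IsReducedFreeProduct (M N : VonNeumannAlgebra H) (A : ℕ → VonNeumannAlgebra H)
    (E : M.toStarSubalgebra →ₗ[ℂ] N.toStarSubalgebra) : Prop where
  condExp : IsNormalFaithfulCondExp M N E
  base_le : ∀ k, N ≤ A k
  le : ∀ k, A k ≤ M
  generates : vnGenerated (⋃ k, (A k : Set (H →L[ℂ] H))) = M
  free : ∀ w : List (ℕ × M.toStarSubalgebra), w ≠ [] → IsReducedWord A E w → E (wordProd w) = 0

/-- Finite sums of reduced words of length `m`; for `m = 0` this is the algebra `N` of amalgamation,
which plays the role of the constants. -/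
noncomputable def homogeneousPoly {M N : VonNeumannAlgebra H} (A : ℕ → VonNeumannAlgebra H)
    (E : M.toStarSubalgebra →ₗ[ℂ] N.toStarSubalgebra) :
    ℕ → Submodule ℂ M.toStarSubalgebra
  | 0 => Submodule.span ℂ {a | (a : H →L[ℂ] H) ∈ N}
  | m + 1 => Submodule.span ℂ
      {a | ∃ w : List (ℕ × M.toStarSubalgebra),
        IsReducedWord A E w ∧ w.length = m + 1 ∧ a = wordProd w}

/-- The space of free polynomials of degree at most `d`: the norm closure in `M` of the sums of
homogeneous free polynomials of degrees `0, …, d`. -/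
noncomputable def freePoly {M N : VonNeumannAlgebra H} (A : ℕ → VonNeumannAlgebra H)
    (E : M.toStarSubalgebra →ₗ[ℂ] N.toStarSubalgebra) (d : ℕ) :
    Submodule ℂ M.toStarSubalgebra :=
  (⨆ m ∈ Finset.range (d + 1), homogeneousPoly A E m).topologicalClosure

/-- The natural filtration: the von Neumann algebra generated by `A 0, …, A n`. -/
noncomputable def freeFiltration (A : ℕ → VonNeumannAlgebra H) (n : ℕ) : VonNeumannAlgebra H :=
  vnGenerated (⋃ i ∈ Finset.range (n + 1), (A i : Set (H →L[ℂ] H)))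

/-- `y` is the conditional expectation of `x` onto the von Neumann subalgebra `P` of `M`, relative
to the faithful conditional expectation `E`: it is the element of `P` such that
`E (a * y) = E (a * x)` for all `a ∈ P`. -/
def IsCondExpOf {M N : VonNeumannAlgebra H}
    (E : M.toStarSubalgebra →ₗ[ℂ] N.toStarSubalgebra) (P : VonNeumannAlgebra H)
    (x y : M.toStarSubalgebra) : Prop :=
  (y : H →L[ℂ] H) ∈ P ∧
    ∀ a : M.toStarSubalgebra, (a : H →L[ℂ] H) ∈ P → E (a * y) = E (a * x)

/-- For any conditional expectation `F : M → P` with `E ∘ F = E`, the preceding relation says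
exactly that `y = F x`. -/
theorem isCondExpOf_iff {M N P : VonNeumannAlgebra H}
    {E : M.toStarSubalgebra →ₗ[ℂ] N.toStarSubalgebra} (hE : IsNormalFaithfulCondExp M N E)
    {F : M.toStarSubalgebra →ₗ[ℂ] P.toStarSubalgebra} (hF : IsNormalFaithfulCondExp M P F)
    (hEF : ∀ a b : M.toStarSubalgebra, (b : H →L[ℂ] H) = (F a : H →L[ℂ] H) → E b = E a)
    (x y : M.toStarSubalgebra) :
    IsCondExpOf E P x y ↔ (y : H →L[ℂ] H) = (F x : H →L[ℂ] H) := by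
  have key : ∀ a z : M.toStarSubalgebra, (a : H →L[ℂ] H) ∈ P →
      (z : H →L[ℂ] H) = (F x : H →L[ℂ] H) → E (a * z) = E (a * x) := by
    intro a z ha hz
    refine hEF _ _ ?_
    have h := hF.bimodule a x 1 ha (one_mem P)
    simp only [mul_one] at h
    rw [h]
    simp [hz]
  constructor
  · rintro ⟨hy, h⟩
    let z : M.toStarSubalgebra := ⟨(F x : H →L[ℂ] H), hF.le (F x).2⟩
    have hz : (z : H →L[ℂ] H) = (F x : H →L[ℂ] H) := rfl
    have hmem : ((star (y - z) : M.toStarSubalgebra) : H →L[ℂ] H) ∈ P := by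
      change star ((y : H →L[ℂ] H) - (F x : H →L[ℂ] H)) ∈ P
      exact star_mem (sub_mem hy (F x).2)
    have h0 : E (star (y - z) * (y - z)) = 0 := by
      rw [mul_sub, map_sub, h _ hmem, key _ z hmem hz, sub_self]
    have h1 := hE.faithful _ h0
    rw [sub_eq_zero.mp h1]
  · intro hy
    exact ⟨hy ▸ (F x).2, fun a ha => key a y ha hy⟩

/-- Martingales for the natural filtration `𝒜 n` of a free product: `x n ∈ 𝒜 n`, and the
conditional expectation of `x (n + 1)` onto `𝒜 n` is `x n`. -/
structure IsFreeMartingale {M N : VonNeumannAlgebra H} (A : ℕ → VonNeumannAlgebra H)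
    (E : M.toStarSubalgebra →ₗ[ℂ] N.toStarSubalgebra) (x : ℕ → M.toStarSubalgebra) : Prop where
  adapted : ∀ n, (x n : H →L[ℂ] H) ∈ freeFiltration A n
  condExp : ∀ n, IsCondExpOf E (freeFiltration A n) (x (n + 1)) (x n)

/-- Martingale differences: `x 0` and `x (k + 1) - x k`. -/
noncomputable def martingaleDiff {M : VonNeumannAlgebra H} (x : ℕ → M.toStarSubalgebra) :
    ℕ → M.toStarSubalgebra
  | 0 => x 0
  | k + 1 => x (k + 1) - x k

/-- The maximum of the norms of the row and the column square function of a finite family of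
operators. -/
noncomputable def squareFunctionNorm (n : ℕ) (y : ℕ → (H →L[ℂ] H)) : ℝ :=
  max ‖CFC.sqrt (∑ k ∈ Finset.range n, y k * star (y k))‖
    ‖CFC.sqrt (∑ k ∈ Finset.range n, star (y k) * y k)‖

end FreeMartingales

/-! ### Strong limits of operators. -/

section OperatorTheory

open Filter Topology
open scoped InnerProductSpace

variable {H : Type u} [NormedAddCommGroup H] [InnerProductSpace ℂ H] [CompleteSpace H]

/-! For each vector `h` the form `⟪h, E (star a * b) h⟫` makes `M` a semi-inner product space, in
which freeness makes reduced words with different index sequences orthogonal. Let `P k` be the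
projection onto the words having `k` among their first `d` indices.

Write `y k` for the `k`-th difference, `k ≥ 1`. By adaptedness and the martingale property it is a
norm limit of combinations of words of length at most `d` that contain the index `k`
(`martingaleDiff_succ_mem`). Multiply such a word by a word `u` whose first `d` indices avoid `k`.
Letters of the left factor may cancel against the beginning of `u`, but its letter of index `k`
cannot, and that letter ends up among the first `d` (`wordProd_mul_wordProd_mem_wordSpan_take`).
Hence `(1 - P k) (y k) (1 - P k) = 0`, that is, `y k = P k (y k) + (y k) P k - P k (y k) P k`.

A word has at most `d` different indices among its first `d`, so `∑ P k ≤ d`. Let `R` be the square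
function norm. By Cauchy–Schwarz, the first term sums to at most `√d R` through the column square
function, the second to at most `√d R` through the row square function, and the third to at most `d
R`, since each `‖y k‖ ≤ R` (`norm_inner_sum_mul_le`). The difference of index `0`, which may have a
component in `N`, costs one more `R`. The resulting constant is `1 + 2√d + d`.

Two analytic facts support this. First, by faithfulness of `E`, the norm of a limit of polynomials
is controlled by its left multiplication on polynomials, over all `h`
(`norm_le_of_norm_toGNS_mul_le`). Second, polynomials in the letters of index at most `n` are
GNS-dense in the von Neumann algebra `𝒜 n`, which is defined as a bicommutant (`toGNS_mem_closure`).
Normality of `E` enters only here: it makes the GNS map strongly continuous on the unit ball, and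
resolvents supply bounded approximants. Density combines with a norm-contractive truncation of
polynomials (`norm_le_norm_add`) to turn the martingale hypotheses into statements about words. -/

omit [CompleteSpace H] in
theorem ContinuousLinearMap.re_inner_le_of_le {a b : H →L[ℂ] H} (h : a ≤ b) (x : H) :
    (⟪x, a x⟫_ℂ).re ≤ (⟪x, b x⟫_ℂ).re := by
  have := ((ContinuousLinearMap.le_def a b).1 h).re_inner_nonneg_right x
  simp only [sub_apply, inner_sub_right, map_sub] at this
  simpa using this

theorem ContinuousLinearMap.le_of_re_inner_le {a b : H →L[ℂ] H} (ha : IsSelfAdjoint a)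
    (hb : IsSelfAdjoint b) (h : ∀ x, (⟪x, a x⟫_ℂ).re ≤ (⟪x, b x⟫_ℂ).re) : a ≤ b := by
  rw [ContinuousLinearMap.le_def, ContinuousLinearMap.isPositive_def']
  refine ⟨hb.sub ha, fun x => ?_⟩
  rw [ContinuousLinearMap.reApplyInnerSelf_apply, inner_re_symm]
  simpa [inner_sub_right] using h x

/-- This is `c² ≤ c`, obtained by moving one square root of `c` onto the vector. It upgrades
convergence of quadratic forms to norm convergence of vectors. -/
theorem norm_sq_apply_le_of_le_one {c : H →L[ℂ] H} (h0 : 0 ≤ c) (h1 : c ≤ 1) (x : H) :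
    ‖c x‖ ^ 2 ≤ (⟪x, c x⟫_ℂ).re := by
  set s := CFC.sqrt c
  have hs : s * s = c := CFC.sqrt_mul_sqrt_self c
  have hsa : IsSelfAdjoint s := (CFC.sqrt_nonneg c).isSelfAdjoint
  have hcx : c x = s (s x) := by rw [← hs]; rfl
  have key : ∀ z, ‖s z‖ ^ 2 = (⟪z, c z⟫_ℂ).re := by
    intro z
    have h2 : ⟪s z, s z⟫_ℂ = ⟪z, s (s z)⟫_ℂ := by
      conv_lhs => rw [← hsa.adjoint_eq]
      rw [ContinuousLinearMap.adjoint_inner_left, hsa.adjoint_eq]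
    rw [← hs, mul_apply_eq_comp, ← h2, inner_self_eq_norm_sq_to_K]
    norm_cast
  rw [← key x, hcx, key (s x)]
  refine (ContinuousLinearMap.re_inner_le_of_le h1 (s x)).trans ?_
  rw [one_apply_eq_self, inner_self_eq_norm_sq_to_K]
  norm_cast

theorem star_mul_self_le_self {g : H →L[ℂ] H} (h0 : 0 ≤ g) (h1 : g ≤ 1) : star g * g ≤ g := by
  refine ContinuousLinearMap.le_of_re_inner_le (.star_mul_self _) h0.isSelfAdjoint fun x => ?_
  rw [mul_apply_eq_comp, ContinuousLinearMap.star_eq_adjoint,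
    ContinuousLinearMap.adjoint_inner_right, inner_self_eq_norm_sq_to_K]
  refine le_trans (le_of_eq ?_) (norm_sq_apply_le_of_le_one h0 h1 x)
  norm_cast

/-- A directed family of positive contractions converges strongly to its supremum. -/
theorem exists_isLUB_tendsto {D : Set (H →L[ℂ] H)} (hne : D.Nonempty)
    (hdir : DirectedOn (· ≤ ·) D) (h0 : ∀ a ∈ D, 0 ≤ a) (h1 : ∀ a ∈ D, a ≤ 1) :
    ∃ s : H →L[ℂ] H, IsLUB D s ∧ ∀ x, Tendsto (fun a : D => (a : H →L[ℂ] H) x) atTop (𝓝 (s x)) := by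
  have : Nonempty D := hne.to_subtype
  have : IsDirectedOrder D := directedOn_iff_isDirectedOrder.1 hdir
  have hlim : ∀ x : H, ∃ y, Tendsto (fun a : D => (a : H →L[ℂ] H) x) atTop (𝓝 y) := by
    intro x
    apply cauchy_map_iff_exists_tendsto.1
    let g : D → ℝ := fun a => (⟪x, (a : H →L[ℂ] H) x⟫_ℂ).re
    have hb : BddAbove (Set.range g) := by
      refine ⟨(⟪x, (1 : H →L[ℂ] H) x⟫_ℂ).re, ?_⟩
      rintro _ ⟨a, rfl⟩
      exact ContinuousLinearMap.re_inner_le_of_le (h1 a a.2) x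
    refine Metric.cauchy_iff.2 ⟨inferInstance, fun ε hε => ?_⟩
    -- The quadratic forms increase to a finite supremum. Beyond `a0` the difference `a - a0` is a
    -- positive contraction, so `‖(a - a0) x‖² ≤ g a - g a0 < (ε / 2)²`.
    obtain ⟨a0, ha0⟩ := exists_lt_of_lt_ciSup (sub_lt_self (⨆ a, g a) (show 0 < (ε / 2) ^ 2 by positivity))
    refine ⟨(fun a : D => (a : H →L[ℂ] H) x) '' Set.Ici a0, image_mem_map (Ici_mem_atTop a0), ?_⟩
    have key : ∀ a : D, a0 ≤ a → dist ((a : H →L[ℂ] H) x) ((a0 : H →L[ℂ] H) x) < ε / 2 := by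
      intro a ha
      have hc0 : (0 : H →L[ℂ] H) ≤ a - a0 := sub_nonneg.2 ha
      have hc1 : (a - a0 : H →L[ℂ] H) ≤ 1 := (sub_le_self _ (h0 a0 a0.2)).trans (h1 a a.2)
      have h := norm_sq_apply_le_of_le_one hc0 hc1 x
      have h2 : (⟪x, (a - a0 : H →L[ℂ] H) x⟫_ℂ).re = g a - g a0 := by
        simp [g]
      have h3 : g a ≤ ⨆ a, g a := le_ciSup hb a
      rw [dist_eq_norm]
      rw [h2, sub_apply] at h
      exact lt_of_pow_lt_pow_left₀ 2 (by positivity) (by linarith)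
    rintro _ ⟨a, ha, rfl⟩ _ ⟨b, hb, rfl⟩
    have := dist_triangle_right ((a : H →L[ℂ] H) x) ((b : H →L[ℂ] H) x) ((a0 : H →L[ℂ] H) x)
    linarith [key a ha, key b hb]
  choose f hf using hlim
  have hbdd : Bornology.IsBounded (Set.range fun a : D => (a : H →L[ℂ] H)) := by
    refine (Metric.isBounded_closedBall (x := (0 : H →L[ℂ] H)) (r := ‖(1 : H →L[ℂ] H)‖)).subset ?_
    rintro _ ⟨a, rfl⟩
    rw [mem_closedBall_zero_iff]
    exact CStarAlgebra.norm_le_norm_of_nonneg_of_le (h0 a a.2) (h1 a a.2)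
  let s : H →L[ℂ] H := ContinuousLinearMap.ofTendstoOfBoundedRange f (fun a : D => (a : H →L[ℂ] H))
    (tendsto_pi_nhds.2 hf) hbdd
  have hs : ∀ x, Tendsto (fun a : D => (a : H →L[ℂ] H) x) atTop (𝓝 (s x)) := hf
  have hin : ∀ x, Tendsto (fun a : D => (⟪x, (a : H →L[ℂ] H) x⟫_ℂ).re) atTop
      (𝓝 (⟪x, s x⟫_ℂ).re) := fun x =>
    (Complex.continuous_re.tendsto _).comp (tendsto_const_nhds.inner (hs x))
  have hsa : IsSelfAdjoint s := by
    rw [ContinuousLinearMap.isSelfAdjoint_iff_isSymmetric]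
    intro x y
    refine tendsto_nhds_unique ((hs x).inner tendsto_const_nhds) (Tendsto.congr (fun a => ?_)
      (tendsto_const_nhds.inner (hs y)))
    exact ((ContinuousLinearMap.isSelfAdjoint_iff_isSymmetric.1 (h0 a a.2).isSelfAdjoint) x y).symm
  refine ⟨s, ⟨fun a ha => ?_, fun b hb => ?_⟩, hs⟩
  · refine ContinuousLinearMap.le_of_re_inner_le (h0 a ha).isSelfAdjoint hsa fun x => ?_
    exact ge_of_tendsto (hin x) ((eventually_ge_atTop (⟨a, ha⟩ : D)).mono fun c hc =>
      ContinuousLinearMap.re_inner_le_of_le hc x)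
  · have hbsa : IsSelfAdjoint b := by
      obtain ⟨a, ha⟩ := hne
      exact ((h0 a ha).trans (hb ha)).isSelfAdjoint
    refine ContinuousLinearMap.le_of_re_inner_le hsa hbsa fun x => ?_
    exact le_of_tendsto (hin x) (Eventually.of_forall fun c =>
      ContinuousLinearMap.re_inner_le_of_le (hb c.2) x)

/-- A vector orthogonal to the orthogonal complement of a real subspace lies in its closure. -/
theorem mem_closure_of_re_inner_eq_zero {s : Set H} (h0 : (0 : H) ∈ s)
    (hadd : ∀ x ∈ s, ∀ y ∈ s, x + y ∈ s) (hsmul : ∀ c : ℝ, ∀ x ∈ s, (c : ℂ) • x ∈ s) {x : H}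
    (hx : ∀ z, (∀ w ∈ s, (⟪w, z⟫_ℂ).re = 0) → (⟪x, z⟫_ℂ).re = 0) : x ∈ closure s := by
  -- Real scalars are needed because the intended subspace, the orbit of a vector under self-adjoint
  -- operators, is only real linear.
  let _ : InnerProductSpace ℝ H := InnerProductSpace.rclikeToReal ℂ H
  let R : Submodule ℝ H :=
    { carrier := s
      zero_mem' := h0
      add_mem' := fun {x y} hx hy => hadd x hx y hy
      smul_mem' := fun c x hx => by exact hsmul c x hx }
  have : x ∈ R.topologicalClosure := by
    refine (Submodule.orthogonal_orthogonal_eq_closure (𝕜 := ℝ) (E := H) R).le ?_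
    refine (Submodule.mem_orthogonal' _ _).2 ?_
    intro z hz
    rw [real_inner_eq_re_inner ℂ]
    refine hx z fun w hw => ?_
    have := (Submodule.mem_orthogonal R z).1 hz w hw
    rwa [real_inner_eq_re_inner ℂ] at this
  exact this

/-! ### The double commutant theorem on finitely many vectors. -/

section DoubleCommutant

variable {ι : Type*} [Fintype ι]

/-- The diagonal amplification of an operator to a finite direct sum. -/
noncomputable def amplification (ι : Type*) [Fintype ι] (a : H →L[ℂ] H) :
    PiLp 2 (fun _ : ι => H) →L[ℂ] PiLp 2 (fun _ : ι => H) :=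
  ((PiLp.continuousLinearEquiv 2 ℂ fun _ : ι => H).symm : _ →L[ℂ] _) ∘L
    ContinuousLinearMap.pi fun i => a ∘L PiLp.proj 2 (fun _ : ι => H) i

omit [CompleteSpace H] in
@[simp]
theorem amplification_apply (a : H →L[ℂ] H) (v : PiLp 2 (fun _ : ι => H)) (i : ι) :
    amplification ι a v i = a (v i) := rfl

theorem amplification_mem_closure (S : StarSubalgebra ℂ (H →L[ℂ] H)) {y : H →L[ℂ] H}
    (hy : y ∈ Set.centralizer (Set.centralizer (S : Set (H →L[ℂ] H))))
    (v : PiLp 2 (fun _ : ι => H)) :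
    amplification ι y v ∈ closure ((fun a => amplification ι a v) '' (S : Set (H →L[ℂ] H))) := by
  classical
  let C₀ : Submodule ℂ (PiLp 2 (fun _ : ι => H)) :=
    { carrier := (fun a => amplification ι a v) '' (S : Set (H →L[ℂ] H))
      zero_mem' := ⟨0, zero_mem S, by ext; simp⟩
      add_mem' := by
        rintro _ _ ⟨a, ha, rfl⟩ ⟨b, hb, rfl⟩
        exact ⟨a + b, add_mem ha hb, by ext; simp⟩
      smul_mem' := by
        rintro c _ ⟨a, ha, rfl⟩
        exact ⟨c • a, S.smul_mem ha c, by ext; simp⟩ }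
  let C := C₀.topologicalClosure
  have hinv : ∀ a ∈ S, ∀ w ∈ C, amplification ι a w ∈ C := by
    intro a ha w hw
    refine map_mem_closure (amplification ι a).continuous hw ?_
    rintro _ ⟨b, hb, rfl⟩
    exact ⟨a * b, mul_mem ha hb, by ext; simp⟩
  have hadj : ∀ (a : H →L[ℂ] H) (w z : PiLp 2 (fun _ : ι => H)),
      ⟪amplification ι a w, z⟫_ℂ = ⟪w, amplification ι (star a) z⟫_ℂ := by
    intro a w z
    simp only [PiLp.inner_apply, amplification_apply]
    refine Finset.sum_congr rfl fun i _ => ?_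
    rw [ContinuousLinearMap.star_eq_adjoint, ContinuousLinearMap.adjoint_inner_right]
  have hinv' : ∀ a ∈ S, ∀ w ∈ Cᗮ, amplification ι a w ∈ Cᗮ := by
    intro a ha w hw
    rw [Submodule.mem_orthogonal'] at hw ⊢
    intro z hz
    rw [hadj]
    exact hw _ (hinv _ (star_mem ha) _ hz)
  have hcomm : ∀ a ∈ S, ∀ w, C.starProjection (amplification ι a w) =
      amplification ι a (C.starProjection w) := by
    intro a ha w
    refine Submodule.eq_starProjection_of_mem_orthogonal (u := amplification ι a w)
      (hinv a ha _ (Submodule.starProjection_apply_mem C w)) ?_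
    rw [← map_sub]
    exact hinv' a ha _ (Submodule.sub_starProjection_mem_orthogonal w)
  let inc : ι → H →L[ℂ] PiLp 2 (fun _ : ι => H) := fun j =>
    ((PiLp.continuousLinearEquiv 2 ℂ fun _ : ι => H).symm : _ →L[ℂ] _) ∘L
      ContinuousLinearMap.single ℂ (fun _ : ι => H) j
  have hinc : ∀ a j x, amplification ι a (inc j x) = inc j (a x) := by
    intro a j x
    ext i
    by_cases h : i = j
    · subst h; simp [inc]
    · simp [inc, h]
  have hsum : ∀ w : PiLp 2 (fun _ : ι => H), w = ∑ j, inc j (w j) := by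
    intro w
    ext i
    simp [inc, Pi.single_apply]
  -- The matrix entries of the projection onto the closed orbit of `v` lie in the commutant of `S`.
  -- So `y` commutes with each entry, and its amplification commutes with the projection.
  let P : ι → ι → H →L[ℂ] H := fun i j => PiLp.proj 2 (fun _ : ι => H) i ∘L C.starProjection ∘L inc j
  have hP : ∀ i j, P i j ∈ Set.centralizer (S : Set (H →L[ℂ] H)) := by
    intro i j a ha
    ext x
    change a (C.starProjection (inc j x) i) = C.starProjection (inc j (a x)) i
    rw [← hinc, hcomm a ha]
    rfl
  have hy' : C.starProjection (amplification ι y v) = amplification ι y (C.starProjection v) := by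
    ext i
    have : ∀ (f : ι → PiLp 2 (fun _ : ι => H)), (∑ j, f j) i = ∑ j, f j i := by
      intro f; simp
    rw [amplification_apply, hsum v]
    simp only [map_sum, hinc]
    rw [this, this, map_sum]
    refine Finset.sum_congr rfl fun j _ => ?_
    have := hy (P i j) (hP i j)
    exact DFunLike.congr_fun this (v j)
  have hv : v ∈ C := C₀.le_topologicalClosure ⟨1, one_mem S, by ext; simp⟩
  rw [Submodule.starProjection_eq_self_iff.2 hv] at hy'
  exact Submodule.starProjection_eq_self_iff.1 hy'

/-- The double commutant theorem for finitely many vectors. -/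
theorem exists_seq_tendsto_of_mem_bicommutant (S : StarSubalgebra ℂ (H →L[ℂ] H)) {y : H →L[ℂ] H}
    (hy : y ∈ Set.centralizer (Set.centralizer (S : Set (H →L[ℂ] H)))) (v : ι → H) :
    ∃ a : ℕ → H →L[ℂ] H, (∀ n, a n ∈ S) ∧ ∀ i, Tendsto (fun n => a n (v i)) atTop (𝓝 (y (v i))) := by
  obtain ⟨f, hf, hlim⟩ := mem_closure_iff_seq_limit.1
    (amplification_mem_closure S hy (WithLp.toLp 2 v))
  choose a ha hfa using hf
  refine ⟨a, ha, fun i => ?_⟩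
  have hi : Tendsto (fun n => f n i) atTop (𝓝 (y (v i))) :=
    ((PiLp.proj 2 (𝕜 := ℂ) (fun _ : ι => H) i).continuous.tendsto _).comp hlim
  refine hi.congr fun n => ?_
  rw [← hfa n]
  rfl

/-- The double commutant theorem for self-adjoint operators and finitely many vectors. -/
theorem exists_seq_selfAdjoint_tendsto_of_mem_bicommutant (S : StarSubalgebra ℂ (H →L[ℂ] H))
    {y : H →L[ℂ] H} (hy : y ∈ Set.centralizer (Set.centralizer (S : Set (H →L[ℂ] H))))
    (hysa : IsSelfAdjoint y) (v : ι → H) :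
    ∃ b : ℕ → H →L[ℂ] H, (∀ n, b n ∈ S ∧ IsSelfAdjoint (b n)) ∧
      ∀ i, Tendsto (fun n => b n (v i)) atTop (𝓝 (y (v i))) := by
  let v' : PiLp 2 (fun _ : ι => H) := WithLp.toLp 2 v
  have hmem : amplification ι y v' ∈
      closure ((fun a => amplification ι a v') '' {b | b ∈ S ∧ IsSelfAdjoint b}) := by
    refine mem_closure_of_re_inner_eq_zero ?_ ?_ ?_ fun z hz => ?_
    · exact ⟨0, ⟨zero_mem S, .zero _⟩, by ext; simp⟩
    · rintro _ ⟨a, ha, rfl⟩ _ ⟨b, hb, rfl⟩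
      exact ⟨a + b, ⟨add_mem ha.1 hb.1, ha.2.add hb.2⟩, by ext; simp⟩
    · rintro c _ ⟨a, ha, rfl⟩
      refine ⟨(c : ℂ) • a, ⟨S.smul_mem ha.1 _, ?_⟩, by ext; simp⟩
      exact IsSelfAdjoint.smul (by simp [IsSelfAdjoint]) ha.2
    -- Approximating on both `v` and `z` controls the adjoints as well: the pairing of `(a + star a)
    -- v` with `z` involves only `a v` and `a z`. It vanishes along the sequence, and its limit is
    -- the pairing for `y + star y = 2 y`.
    obtain ⟨a, ha, hlim⟩ := exists_seq_tendsto_of_mem_bicommutant S hy (Sum.elim v (fun i => z i))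
    have key : ∀ c : H →L[ℂ] H, (⟪amplification ι (c + star c) v', z⟫_ℂ).re =
        ∑ i, ((⟪c (v i), z i⟫_ℂ).re + (⟪v i, c (z i)⟫_ℂ).re) := by
      intro c
      rw [PiLp.inner_apply, Complex.re_sum]
      refine Finset.sum_congr rfl fun i _ => ?_
      rw [amplification_apply, add_apply, inner_add_left, ContinuousLinearMap.star_eq_adjoint,
        ContinuousLinearMap.adjoint_inner_left]
      rfl
    have h1 : Tendsto (fun n => ∑ i, ((⟪a n (v i), z i⟫_ℂ).re + (⟪v i, a n (z i)⟫_ℂ).re)) atTop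
        (𝓝 (∑ i, ((⟪y (v i), z i⟫_ℂ).re + (⟪v i, y (z i)⟫_ℂ).re))) := by
      refine tendsto_finsetSum _ fun i _ => Tendsto.add ?_ ?_
      · exact (Complex.continuous_re.tendsto _).comp ((hlim (Sum.inl i)).inner tendsto_const_nhds)
      · exact (Complex.continuous_re.tendsto _).comp (tendsto_const_nhds.inner (hlim (Sum.inr i)))
    have h2 : ∀ n, ∑ i, ((⟪a n (v i), z i⟫_ℂ).re + (⟪v i, a n (z i)⟫_ℂ).re) = 0 := by
      intro n
      rw [← key]
      exact hz _ ⟨_, ⟨add_mem (ha n) (star_mem (ha n)), IsSelfAdjoint.add_star_self _⟩, rfl⟩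
    have h3 := tendsto_nhds_unique h1 (by simp only [h2]; exact tendsto_const_nhds)
    rw [← key, hysa.star_eq] at h3
    have h4 : amplification ι (y + y) v' = amplification ι y v' + amplification ι y v' := by
      ext; simp
    rw [h4, inner_add_left, Complex.add_re] at h3
    linarith
  obtain ⟨f, hf, hlim⟩ := mem_closure_iff_seq_limit.1
    hmem
  choose b hb hfb using hf
  refine ⟨b, hb, fun i => ?_⟩
  have hi : Tendsto (fun n => f n i) atTop (𝓝 (y (v i))) :=
    ((PiLp.proj 2 (𝕜 := ℂ) (fun _ : ι => H) i).continuous.tendsto _).comp hlim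
  refine hi.congr fun n => ?_
  rw [← hfb n]
  rfl

end DoubleCommutant

end OperatorTheory

/-! ### The GNS spaces of a conditional expectation. -/

section CondExp

open Filter Topology
open scoped InnerProductSpace

variable {H : Type u} [NormedAddCommGroup H] [InnerProductSpace ℂ H] [CompleteSpace H]

namespace VonNeumannAlgebra

theorem isClosed (M : VonNeumannAlgebra H) : IsClosed (M : Set (H →L[ℂ] H)) := by
  rw [← M.centralizer_centralizer]
  exact Set.isClosed_centralizer _

theorem sqrt_mem (M : VonNeumannAlgebra H) {a : H →L[ℂ] H} (ha : a ∈ M) (h : 0 ≤ a) :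
    CFC.sqrt a ∈ M := by
  have : IsClosed (M.toStarSubalgebra : Set (H →L[ℂ] H)) := M.isClosed
  rw [CFC.sqrt_eq_real_sqrt a, cfcₙ_eq_cfc]
  exact _root_.cfc_mem (s := M.toStarSubalgebra) _ ha

end VonNeumannAlgebra

namespace IsNormalFaithfulCondExp

variable {M N : VonNeumannAlgebra H} {E : M.toStarSubalgebra →ₗ[ℂ] N.toStarSubalgebra}

theorem map_nonneg (hE : IsNormalFaithfulCondExp M N E) {a : M.toStarSubalgebra}
    (ha : 0 ≤ (a : H →L[ℂ] H)) : 0 ≤ (E a : H →L[ℂ] H) := by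
  let s : M.toStarSubalgebra := ⟨CFC.sqrt (a : H →L[ℂ] H), M.sqrt_mem a.2 ha⟩
  have : star s * s = a := by
    apply Subtype.ext
    change star (CFC.sqrt (a : H →L[ℂ] H)) * CFC.sqrt (a : H →L[ℂ] H) = a
    rw [(CFC.sqrt_nonneg (a : H →L[ℂ] H)).isSelfAdjoint.star_eq, CFC.sqrt_mul_sqrt_self _ ha]
  rw [← this]
  exact hE.nonneg s

theorem map_one (hE : IsNormalFaithfulCondExp M N E) : (E 1 : H →L[ℂ] H) = 1 :=
  hE.apply_of_mem 1 (one_mem N)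

/-- Polarization: `E (star c * c)` is positive, hence self-adjoint, for `c = a + b` and `c = a + I •
b`. -/
theorem map_star_mul (hE : IsNormalFaithfulCondExp M N E) (a b : M.toStarSubalgebra) :
    star (E (star a * b) : H →L[ℂ] H) = (E (star b * a) : H →L[ℂ] H) := by
  have key : ∀ c : M.toStarSubalgebra, star (E (star c * c) : H →L[ℂ] H) = E (star c * c) :=
    fun c => (hE.nonneg c).isSelfAdjoint.star_eq
  have h1 := key (a + b)
  have h2 := key (a + Complex.I • b)
  simp only [star_add, add_mul, mul_add, map_add, star_smul, smul_mul_assoc, mul_smul_comm,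
    map_smul, AddMemClass.coe_add, SetLike.val_smul, key,
    Complex.star_def, Complex.conj_I, neg_smul, neg_neg, star_neg, map_neg,
    NegMemClass.coe_neg, neg_mul, smul_neg, smul_add] at h1 h2
  have h1' : star (E (star a * b) : H →L[ℂ] H) + star (E (star b * a) : H →L[ℂ] H) =
      (E (star a * b) : H →L[ℂ] H) + (E (star b * a) : H →L[ℂ] H) := by
    linear_combination (norm := module) h1
  have h2' : Complex.I • (star (E (star b * a) : H →L[ℂ] H) - star (E (star a * b) : H →L[ℂ] H)) =
      Complex.I • ((E (star a * b) : H →L[ℂ] H) - (E (star b * a) : H →L[ℂ] H)) := by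
    rw [smul_sub, smul_sub]
    linear_combination (norm := module) h2
  have h3 := smul_right_injective (H →L[ℂ] H) Complex.I_ne_zero h2'
  have h4 : (2 : ℂ) • (star (E (star a * b) : H →L[ℂ] H)) = (2 : ℂ) • (E (star b * a) : H →L[ℂ] H) := by
    rw [two_smul, two_smul]
    linear_combination (norm := module) h1' - h3
  exact smul_right_injective (H →L[ℂ] H) two_ne_zero h4

/-- The algebra `M` with the semi-inner product `(a, b) ↦ ⟪h, E (a* b) h⟫`. -/
def GNS (_ : IsNormalFaithfulCondExp M N E) (_ : H) : Type u := M.toStarSubalgebra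

noncomputable instance (hE : IsNormalFaithfulCondExp M N E) (h : H) : AddCommGroup (hE.GNS h) :=
  inferInstanceAs (AddCommGroup M.toStarSubalgebra)

noncomputable instance (hE : IsNormalFaithfulCondExp M N E) (h : H) : Module ℂ (hE.GNS h) :=
  inferInstanceAs (Module ℂ M.toStarSubalgebra)

/-- The identity map from `M` to its GNS space. -/
noncomputable def toGNS (hE : IsNormalFaithfulCondExp M N E) (h : H) :
    M.toStarSubalgebra ≃ₗ[ℂ] hE.GNS h := LinearEquiv.refl ℂ _

/-- The semi-inner product of the GNS space. -/
noncomputable abbrev gnsCore (hE : IsNormalFaithfulCondExp M N E) (h : H) :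
    PreInnerProductSpace.Core ℂ (hE.GNS h) where
  inner a b := ⟪h, (E (star ((hE.toGNS h).symm a) * (hE.toGNS h).symm b) : H →L[ℂ] H) h⟫_ℂ
  conj_inner_symm a b := by
    rw [inner_conj_symm, ← hE.map_star_mul, ContinuousLinearMap.star_eq_adjoint,
      ContinuousLinearMap.adjoint_inner_left]
  re_inner_nonneg a :=
    ((ContinuousLinearMap.nonneg_iff_isPositive _).1 (hE.nonneg _)).re_inner_nonneg_right h
  add_left a b c := by
    simp [add_mul]
  smul_left a b c := by
    simp

noncomputable instance (hE : IsNormalFaithfulCondExp M N E) (h : H) :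
    SeminormedAddCommGroup (hE.GNS h) :=
  InnerProductSpace.Core.toSeminormedAddCommGroup (c := hE.gnsCore h)

noncomputable instance (hE : IsNormalFaithfulCondExp M N E) (h : H) :
    InnerProductSpace ℂ (hE.GNS h) :=
  InnerProductSpace.ofCore (hE.gnsCore h)

theorem inner_toGNS (hE : IsNormalFaithfulCondExp M N E) (h : H) (a b : M.toStarSubalgebra) :
    ⟪hE.toGNS h a, hE.toGNS h b⟫_ℂ = ⟪h, (E (star a * b) : H →L[ℂ] H) h⟫_ℂ := rfl

theorem norm_toGNS_sq (hE : IsNormalFaithfulCondExp M N E) (h : H) (a : M.toStarSubalgebra) :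
    ‖hE.toGNS h a‖ ^ 2 = (⟪h, (E (star a * a) : H →L[ℂ] H) h⟫_ℂ).re := by
  rw [← inner_toGNS, inner_self_eq_norm_sq_to_K]
  norm_cast

theorem inner_toGNS_mul (hE : IsNormalFaithfulCondExp M N E) (h : H) (c a b : M.toStarSubalgebra) :
    ⟪hE.toGNS h (c * a), hE.toGNS h b⟫_ℂ = ⟪hE.toGNS h a, hE.toGNS h (star c * b)⟫_ℂ := by
  rw [inner_toGNS, inner_toGNS, star_mul, mul_assoc]

theorem re_inner_mono (hE : IsNormalFaithfulCondExp M N E) (h : H) {a b : M.toStarSubalgebra}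
    (hab : (a : H →L[ℂ] H) ≤ b) :
    (⟪h, (E a : H →L[ℂ] H) h⟫_ℂ).re ≤ (⟪h, (E b : H →L[ℂ] H) h⟫_ℂ).re := by
  refine ContinuousLinearMap.re_inner_le_of_le ?_ h
  have := hE.map_nonneg (a := b - a) (by simpa using hab)
  simpa using this

/-- With `T = ∑ star (c i) * c i`, this is `star a * T * a ≤ ‖T‖ • (star a * a)` followed by
positivity of `E`. It is the entry point of the square functions, column for `c i` and row for `star
(c i)`. -/
theorem sum_norm_toGNS_mul_sq_le (hE : IsNormalFaithfulCondExp M N E) (h : H) {ι : Type*}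
    (s : Finset ι) (c : ι → M.toStarSubalgebra) (a : M.toStarSubalgebra) :
    ∑ i ∈ s, ‖hE.toGNS h (c i * a)‖ ^ 2 ≤
      ‖∑ i ∈ s, star (c i : H →L[ℂ] H) * (c i : H →L[ℂ] H)‖ * ‖hE.toGNS h a‖ ^ 2 := by
  set T : M.toStarSubalgebra := ∑ i ∈ s, star (c i) * c i with hT
  have hTc : (T : H →L[ℂ] H) = ∑ i ∈ s, star (c i : H →L[ℂ] H) * (c i : H →L[ℂ] H) := by
    simp [hT]
  rw [← hTc]
  have hTn : 0 ≤ (T : H →L[ℂ] H) := by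
    rw [hTc]; exact Finset.sum_nonneg fun i _ => star_mul_self_nonneg _
  have h1 : ∑ i ∈ s, ‖hE.toGNS h (c i * a)‖ ^ 2 = (⟪h, (E (star a * T * a) : H →L[ℂ] H) h⟫_ℂ).re := by
    have : star a * T * a = ∑ i ∈ s, star (c i * a) * (c i * a) := by
      rw [hT, Finset.mul_sum, Finset.sum_mul]
      simp [mul_assoc]
    rw [this, map_sum]
    simp only [AddSubmonoidClass.coe_finsetSum, sum_apply, inner_sum,
      Complex.re_sum, norm_toGNS_sq]
  have h2 : ((star a * T * a : M.toStarSubalgebra) : H →L[ℂ] H) ≤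
      (((‖(T : H →L[ℂ] H)‖ : ℂ) • (star a * a) : M.toStarSubalgebra) : H →L[ℂ] H) := by
    have h3 := star_left_conjugate_le_conjugate (IsSelfAdjoint.le_algebraMap_norm_self (a := (T : H →L[ℂ] H)) hTn.isSelfAdjoint) (a : H →L[ℂ] H)
    refine h3.trans (le_of_eq ?_)
    rw [Algebra.algebraMap_eq_smul_one]
    simp
  rw [h1]
  refine (hE.re_inner_mono h h2).trans (le_of_eq ?_)
  rw [map_smul, norm_toGNS_sq]
  simp

theorem norm_toGNS_mul_le (hE : IsNormalFaithfulCondExp M N E) (h : H) (c a : M.toStarSubalgebra) :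
    ‖hE.toGNS h (c * a)‖ ≤ ‖(c : H →L[ℂ] H)‖ * ‖hE.toGNS h a‖ := by
  have := hE.sum_norm_toGNS_mul_sq_le h {()} (fun _ => c) a
  simp only [Finset.sum_singleton, CStarRing.norm_star_mul_self] at this
  refine le_of_sq_le_sq ?_ (by positivity)
  rw [mul_pow, sq ‖(c : H →L[ℂ] H)‖]
  exact this

theorem norm_toGNS_le (hE : IsNormalFaithfulCondExp M N E) (h : H) (a : M.toStarSubalgebra) :
    ‖hE.toGNS h a‖ ≤ ‖(a : H →L[ℂ] H)‖ * ‖h‖ := by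
  have h1 := hE.norm_toGNS_mul_le h a 1
  have h2 : ‖hE.toGNS h 1‖ ^ 2 = ‖h‖ ^ 2 := by
    rw [norm_toGNS_sq, star_one, one_mul, hE.map_one, one_apply_eq_self,
      inner_self_eq_norm_sq_to_K]
    norm_cast
  rw [(sq_eq_sq₀ (norm_nonneg _) (norm_nonneg _)).1 h2, mul_one] at h1
  exact h1

theorem continuous_toGNS (hE : IsNormalFaithfulCondExp M N E) (h : H) :
    Continuous (hE.toGNS h) := by
  refine AddMonoidHomClass.continuous_of_bound (hE.toGNS h) ‖h‖ fun a => ?_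
  rw [mul_comm]
  exact hE.norm_toGNS_le h a

/-- All vectors `h` together play the role of one faithful state: the quadratic form of `E (star a *
a)` vanishes, and `E` is faithful. -/
theorem eq_zero_of_norm_toGNS (hE : IsNormalFaithfulCondExp M N E) {a : M.toStarSubalgebra}
    (h : ∀ h, ‖hE.toGNS h a‖ = 0) : a = 0 := by
  refine hE.faithful a (Subtype.ext ?_)
  have : ((E (star a * a) : H →L[ℂ] H) : H →ₗ[ℂ] H) = 0 := by
    rw [← inner_map_self_eq_zero]
    intro x
    rw [← inner_conj_symm]
    change starRingEnd ℂ ⟪x, (E (star a * a) : H →L[ℂ] H) x⟫_ℂ = 0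
    rw [← hE.inner_toGNS, inner_self_eq_norm_sq_to_K, h x]
    simp
  exact ContinuousLinearMap.coe_injective this

/-- The key consequence of normality: on positive contractions, `E` commutes with directed suprema
in the sense of the GNS norm. -/
theorem exists_isLUB (hE : IsNormalFaithfulCondExp M N E) (h : H) {D : Set M.toStarSubalgebra}
    (hne : D.Nonempty) (hdir : DirectedOn (· ≤ ·) D) (h0 : ∀ a ∈ D, 0 ≤ (a : H →L[ℂ] H))
    (h1 : ∀ a ∈ D, (a : H →L[ℂ] H) ≤ 1) :
    ∃ s : M.toStarSubalgebra, IsLUB D s ∧ 0 ≤ (s : H →L[ℂ] H) ∧ (s : H →L[ℂ] H) ≤ 1 ∧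
      (∀ x : H, ∀ c : ℝ, (∀ a ∈ D, (⟪x, (a : H →L[ℂ] H) x⟫_ℂ).re ≤ c) →
        (⟪x, (s : H →L[ℂ] H) x⟫_ℂ).re ≤ c) ∧
      ∀ ε > 0, ∃ a ∈ D, ‖hE.toGNS h (s - a)‖ < ε := by
  have hdir' : ∀ f : M.toStarSubalgebra → (H →L[ℂ] H), (∀ a b : M.toStarSubalgebra,
      (a : H →L[ℂ] H) ≤ b → f a ≤ f b) → DirectedOn (· ≤ ·) (f '' D) := by
    rintro f hf _ ⟨a, ha, rfl⟩ _ ⟨b, hb, rfl⟩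
    obtain ⟨c, hc, hac, hbc⟩ := hdir a ha b hb
    exact ⟨f c, ⟨c, hc, rfl⟩, hf _ _ hac, hf _ _ hbc⟩
  have hEmono : ∀ a b : M.toStarSubalgebra, (a : H →L[ℂ] H) ≤ b → (E a : H →L[ℂ] H) ≤ E b := by
    intro a b hab
    have := hE.map_nonneg (a := b - a) (by simpa using hab)
    simpa using this
  obtain ⟨s, hs, hlim⟩ := exists_isLUB_tendsto (D := (fun a : M.toStarSubalgebra => (a : H →L[ℂ] H)) '' D)
    (hne.image _) (hdir' _ fun _ _ h => h) (by rintro _ ⟨a, ha, rfl⟩; exact h0 a ha)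
    (by rintro _ ⟨a, ha, rfl⟩; exact h1 a ha)
  have : Nonempty ((fun a : M.toStarSubalgebra => (a : H →L[ℂ] H)) '' D) := (hne.image _).to_subtype
  have : IsDirectedOrder ((fun a : M.toStarSubalgebra => (a : H →L[ℂ] H)) '' D) :=
    directedOn_iff_isDirectedOrder.1 (hdir' _ fun _ _ h => h)
  have hsM : s ∈ M := by
    rw [← SetLike.mem_coe, ← M.centralizer_centralizer]
    intro t ht
    ext x
    refine tendsto_nhds_unique ((t.continuous.tendsto _).comp (hlim x)) ?_
    refine (hlim (t x)).congr ?_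
    rintro ⟨_, a, ha, rfl⟩
    exact DFunLike.congr_fun (ht _ a.2) x
  have hs0 : 0 ≤ s := by
    obtain ⟨a, ha⟩ := hne
    exact (h0 a ha).trans (hs.1 ⟨a, ha, rfl⟩)
  have hs1 : s ≤ 1 := hs.2 (by rintro _ ⟨a, ha, rfl⟩; exact h1 a ha)
  refine ⟨⟨s, hsM⟩, ⟨fun a ha => hs.1 ⟨a, ha, rfl⟩, fun b hb => hs.2 ?_⟩, hs0, hs1, ?_, ?_⟩
  · rintro _ ⟨a, ha, rfl⟩
    exact hb ha
  · intro x c hc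
    refine le_of_tendsto ((Complex.continuous_re.tendsto _).comp
      (tendsto_const_nhds.inner (hlim x))) (Eventually.of_forall ?_)
    rintro ⟨_, a, ha, rfl⟩
    exact hc a ha
  · intro ε hε
    have hlub := hE.normal D hne (fun a ha => Subtype.ext (h0 a ha).isSelfAdjoint.star_eq) hdir
      ⟨s, hsM⟩ hs
    obtain ⟨s', hs', hlim'⟩ := exists_isLUB_tendsto
      (D := (fun a : M.toStarSubalgebra => (E a : H →L[ℂ] H)) '' D)
      (hne.image _) (hdir' _ hEmono) (by rintro _ ⟨a, ha, rfl⟩; exact hE.map_nonneg (h0 a ha))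
      (by
        rintro _ ⟨a, ha, rfl⟩
        have := hEmono a 1 (h1 a ha)
        rwa [hE.map_one] at this)
    rw [hs'.unique hlub] at hlim'
    have : Nonempty ((fun a : M.toStarSubalgebra => (E a : H →L[ℂ] H)) '' D) := (hne.image _).to_subtype
    have : IsDirectedOrder ((fun a : M.toStarSubalgebra => (E a : H →L[ℂ] H)) '' D) :=
      directedOn_iff_isDirectedOrder.1 (hdir' _ hEmono)
    have h2 := (Complex.continuous_re.tendsto _).comp
      ((tendsto_const_nhds (x := h)).inner (hlim' h))
    obtain ⟨⟨_, a, ha, rfl⟩, hlt⟩ := (h2.eventually (lt_mem_nhds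
      (sub_lt_self _ (show 0 < ε ^ 2 by positivity)))).exists
    refine ⟨a, ha, ?_⟩
    -- Since `s - a` is a positive contraction, its square is at most itself. The squared GNS norm
    -- is thus bounded by the gap between the quadratic forms of `E s` and `E a` at `h`, which
    -- normality makes small.
    have hle : ((star ((⟨s, hsM⟩ : M.toStarSubalgebra) - a) * (⟨s, hsM⟩ - a) : M.toStarSubalgebra) :
        H →L[ℂ] H) ≤ ((⟨s, hsM⟩ - a : M.toStarSubalgebra) : H →L[ℂ] H) := by
      have hp : 0 ≤ s - (a : H →L[ℂ] H) := sub_nonneg.2 (hs.1 ⟨a, ha, rfl⟩)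
      have hp1 : s - (a : H →L[ℂ] H) ≤ 1 := (sub_le_self _ (h0 a ha)).trans hs1
      change star (s - (a : H →L[ℂ] H)) * (s - (a : H →L[ℂ] H)) ≤ s - (a : H →L[ℂ] H)
      exact star_mul_self_le_self hp hp1
    refine lt_of_pow_lt_pow_left₀ 2 hε.le ?_
    rw [norm_toGNS_sq]
    refine (hE.re_inner_mono h hle).trans_lt ?_
    rw [map_sub]
    simp only [Function.comp_apply] at hlt
    simp only [AddSubgroupClass.coe_sub, sub_apply, inner_sub_right, Complex.sub_re]
    linarith

end IsNormalFaithfulCondExp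

end CondExp

/-! ### Normality implies strong continuity on the unit ball. -/

section Density

open Filter Topology
open scoped InnerProductSpace

variable {H : Type u} [NormedAddCommGroup H] [InnerProductSpace ℂ H] [CompleteSpace H]

namespace IsNormalFaithfulCondExp

variable {M N : VonNeumannAlgebra H} {E : M.toStarSubalgebra →ₗ[ℂ] N.toStarSubalgebra}

/-- Right multiplication by `g`, followed by the map to the GNS space, is strongly continuous at `0`
on the unit ball of `M`. -/
def IsStronglyContinuous (hE : IsNormalFaithfulCondExp M N E) (h : H) (g : M.toStarSubalgebra) :
    Prop :=
  ∀ ε > 0, ∃ F : Finset H, ∃ δ > 0, ∀ c : M.toStarSubalgebra, ‖(c : H →L[ℂ] H)‖ ≤ 1 →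
    (∀ η ∈ F, ‖(c : H →L[ℂ] H) η‖ < δ) → ‖hE.toGNS h (c * g)‖ < ε

theorem IsStronglyContinuous.add {hE : IsNormalFaithfulCondExp M N E} {h : H}
    {g₁ g₂ : M.toStarSubalgebra} (h₁ : hE.IsStronglyContinuous h g₁)
    (h₂ : hE.IsStronglyContinuous h g₂) : hE.IsStronglyContinuous h (g₁ + g₂) := by
  classical
  intro ε hε
  obtain ⟨F₁, δ₁, hδ₁, H₁⟩ := h₁ (ε / 2) (half_pos hε)
  obtain ⟨F₂, δ₂, hδ₂, H₂⟩ := h₂ (ε / 2) (half_pos hε)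
  refine ⟨F₁ ∪ F₂, min δ₁ δ₂, lt_min hδ₁ hδ₂, fun c hc hF => ?_⟩
  have a₁ := H₁ c hc fun η hη => (hF η (Finset.mem_union_left _ hη)).trans_le (min_le_left _ _)
  have a₂ := H₂ c hc fun η hη => (hF η (Finset.mem_union_right _ hη)).trans_le (min_le_right _ _)
  rw [mul_add, map_add]
  linarith [norm_add_le (hE.toGNS h (c * g₁)) (hE.toGNS h (c * g₂))]

theorem IsStronglyContinuous.of_approx {hE : IsNormalFaithfulCondExp M N E} {h : H}
    {g : M.toStarSubalgebra}
    (H : ∀ ε > 0, ∃ g', hE.IsStronglyContinuous h g' ∧ ‖hE.toGNS h (g - g')‖ < ε) :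
    hE.IsStronglyContinuous h g := by
  intro ε hε
  obtain ⟨g', hg', hlt⟩ := H (ε / 2) (half_pos hε)
  obtain ⟨F, δ, hδ, H'⟩ := hg' (ε / 2) (half_pos hε)
  refine ⟨F, δ, hδ, fun c hc hF => ?_⟩
  have h1 := H' c hc hF
  have h2 : ‖hE.toGNS h (c * (g - g'))‖ < ε / 2 :=
    (hE.norm_toGNS_mul_le h c (g - g')).trans_lt
      ((mul_le_of_le_one_left (norm_nonneg _) hc).trans_lt hlt)
  have h3 : c * g = c * (g - g') + c * g' := by rw [mul_sub, sub_add_cancel]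
  rw [h3, map_add]
  linarith [norm_add_le (hE.toGNS h (c * (g - g'))) (hE.toGNS h (c * g'))]

/-- A vector functional `ψ`, scaled so that `ψ r > ω r`, dominates `ω` below some nonzero `g ≤ r`:
take `g = r - a` with `a` maximal among `0 ≤ a ≤ r` subject to `ψ a ≤ ω a`. Then `(c g)* (c g) ≤ g`
gives `‖c g‖² ≤ ‖c (g ξ)‖²` in the GNS norm, which is continuity tested on the single vector `g ξ`.
-/
theorem exists_isStronglyContinuous_le (hE : IsNormalFaithfulCondExp M N E) (h : H)
    {r : M.toStarSubalgebra} (h0 : 0 ≤ (r : H →L[ℂ] H)) (h1 : (r : H →L[ℂ] H) ≤ 1) (hr : r ≠ 0) :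
    ∃ g : M.toStarSubalgebra, 0 ≤ (g : H →L[ℂ] H) ∧ (g : H →L[ℂ] H) ≤ r ∧ g ≠ 0 ∧
      hE.IsStronglyContinuous h g := by
  set ω : M.toStarSubalgebra → ℝ := fun a => (⟪h, (E a : H →L[ℂ] H) h⟫_ℂ).re with hω
  obtain ⟨x, hx⟩ : ∃ x, 0 < (⟪x, (r : H →L[ℂ] H) x⟫_ℂ).re := by
    by_contra! hcon
    refine hr (Subtype.ext (le_antisymm ?_ h0))
    exact ContinuousLinearMap.le_of_re_inner_le h0.isSelfAdjoint (.zero _) (by simpa using hcon)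
  obtain ⟨ξ, hξ⟩ : ∃ ξ, ω r < (⟪ξ, (r : H →L[ℂ] H) ξ⟫_ℂ).re := by
    obtain ⟨n, hn⟩ := exists_nat_gt (max 1 (ω r / (⟪x, (r : H →L[ℂ] H) x⟫_ℂ).re))
    have hn1 := (le_max_left _ _).trans_lt hn
    have hn2 := (le_max_right _ _).trans_lt hn
    refine ⟨(n : ℂ) • x, ?_⟩
    rw [div_lt_iff₀ hx] at hn2
    have : (⟪(n : ℂ) • x, (r : H →L[ℂ] H) ((n : ℂ) • x)⟫_ℂ).re =
        n * (n * (⟪x, (r : H →L[ℂ] H) x⟫_ℂ).re) := by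
      rw [map_smul, inner_smul_left, inner_smul_right]
      simp
    rw [this]
    nlinarith [mul_pos (zero_lt_one.trans hn1) hx]
  set ψ : M.toStarSubalgebra → ℝ := fun a => (⟪ξ, (a : H →L[ℂ] H) ξ⟫_ℂ).re with hψ
  have hωadd : ∀ a b, ω (a + b) = ω a + ω b := fun a b => by simp [hω]
  have hψadd : ∀ a b, ψ (a + b) = ψ a + ψ b := fun a b => by simp [hψ]
  obtain ⟨a, -, ha⟩ := zorn_le_nonempty₀
    {a : M.toStarSubalgebra | 0 ≤ (a : H →L[ℂ] H) ∧ (a : H →L[ℂ] H) ≤ r ∧ ψ a ≤ ω a}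
    (by
      intro D hD hchain y hy
      obtain ⟨s, hs, hs0, -, hs2, -⟩ := hE.exists_isLUB h ⟨y, hy⟩ hchain.directedOn
        (fun a ha => (hD ha).1) (fun a ha => (hD ha).2.1.trans h1)
      refine ⟨s, ⟨hs0, hs.2 fun a ha => (hD ha).2.1, hs2 ξ _ fun a ha => ?_⟩, hs.1⟩
      exact (hD ha).2.2.trans (hE.re_inner_mono h (hs.1 ha)))
    0 ⟨le_refl _, h0, by simp [hω, hψ]⟩
  have hg0 : (0 : H →L[ℂ] H) ≤ ((r - a : M.toStarSubalgebra) : H →L[ℂ] H) := by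
    simpa using ha.prop.2.1
  have hgr : ((r - a : M.toStarSubalgebra) : H →L[ℂ] H) ≤ r := by
    simpa using ha.prop.1
  have hg1 := hgr.trans h1
  have key : ∀ b : M.toStarSubalgebra, 0 ≤ (b : H →L[ℂ] H) →
      (b : H →L[ℂ] H) ≤ ((r - a : M.toStarSubalgebra) : H →L[ℂ] H) → ω b ≤ ψ b := by
    intro b hb hbg
    by_contra! hlt
    have hmem : a + b ∈ {a : M.toStarSubalgebra | 0 ≤ (a : H →L[ℂ] H) ∧ (a : H →L[ℂ] H) ≤ r ∧ ψ a ≤ ω a} := by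
      refine ⟨add_nonneg ha.prop.1 hb, ?_, ?_⟩
      · have : (b : H →L[ℂ] H) ≤ (r : H →L[ℂ] H) - a := hbg
        have := add_le_add_right this (a : H →L[ℂ] H)
        simpa using this
      · rw [hωadd, hψadd]
        linarith [ha.prop.2.2]
    have h3 : ((a + b : M.toStarSubalgebra) : H →L[ℂ] H) ≤ a :=
      ha.le_of_ge hmem (show (a : H →L[ℂ] H) ≤ (a : H →L[ℂ] H) + b from le_add_of_nonneg_right hb)
    have h4 : (b : H →L[ℂ] H) ≤ 0 := by simpa using h3
    have h5 : b = 0 := Subtype.ext (le_antisymm h4 hb)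
    rw [h5] at hlt
    simp [hω, hψ] at hlt
  refine ⟨r - a, hg0, hgr, ?_, ?_⟩
  · intro h3
    rw [sub_eq_zero] at h3
    have := ha.prop.2.2
    rw [← h3] at this
    linarith
  · intro ε hε
    refine ⟨{((r - a : M.toStarSubalgebra) : H →L[ℂ] H) ξ}, ε, hε, fun c hc hF => ?_⟩
    set g := r - a
    have hle : ((star (c * g) * (c * g) : M.toStarSubalgebra) : H →L[ℂ] H) ≤ g := by
      have h3 := CStarAlgebra.star_left_conjugate_le_norm_smul (a := (g : H →L[ℂ] H))
        (b := star (c : H →L[ℂ] H) * c) (.star_mul_self _)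
      have h4 : ‖star (c : H →L[ℂ] H) * c‖ ≤ 1 := by
        rw [CStarRing.norm_star_mul_self]
        exact mul_le_one₀ hc (norm_nonneg _) hc
      have h5 : (‖star (c : H →L[ℂ] H) * c‖) • (star (g : H →L[ℂ] H) * g) ≤ star (g : H →L[ℂ] H) * g := by
        have := smul_le_smul_of_nonneg_right h4 (star_mul_self_nonneg (g : H →L[ℂ] H))
        simpa using this
      refine le_trans (le_of_eq ?_) ((h3.trans h5).trans (star_mul_self_le_self hg0 hg1))
      simp [mul_assoc]
    have h3 := key _ (show (0 : H →L[ℂ] H) ≤ ((star (c * g) * (c * g) : M.toStarSubalgebra) : H →L[ℂ] H) from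
      star_mul_self_nonneg ((c : H →L[ℂ] H) * (g : H →L[ℂ] H))) hle
    refine lt_of_pow_lt_pow_left₀ 2 hε.le ?_
    rw [norm_toGNS_sq]
    refine h3.trans_lt ?_
    have h4 : ψ (star (c * g) * (c * g)) = ‖(c : H →L[ℂ] H) ((g : H →L[ℂ] H) ξ)‖ ^ 2 := by
      change (⟪ξ, (star ((c : H →L[ℂ] H) * (g : H →L[ℂ] H)) * ((c : H →L[ℂ] H) * (g : H →L[ℂ] H))) ξ⟫_ℂ).re = _
      rw [mul_apply_eq_comp, ContinuousLinearMap.star_eq_adjoint,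
        ContinuousLinearMap.adjoint_inner_right, inner_self_eq_norm_sq_to_K]
      norm_cast
    rw [h4]
    exact pow_lt_pow_left₀ (hF _ (Finset.mem_singleton_self _)) (norm_nonneg _) two_ne_zero

/-- The map from `M` to its GNS space is strongly continuous on bounded sets. -/
theorem isStronglyContinuous_one (hE : IsNormalFaithfulCondExp M N E) (h : H) :
    hE.IsStronglyContinuous h 1 := by
  -- Exhaustion: take a maximal positive contraction `g` with the continuity property. Chains have
  -- bounds because normality makes their suprema GNS limits. If `g ≠ 1`, a piece found below `1 -
  -- g` could be added.
  obtain ⟨g, -, hg⟩ := zorn_le_nonempty₀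
    {g : M.toStarSubalgebra | 0 ≤ (g : H →L[ℂ] H) ∧ (g : H →L[ℂ] H) ≤ 1 ∧ hE.IsStronglyContinuous h g}
    (by
      intro D hD hchain y hy
      obtain ⟨s, hs, hs0, hs1, -, hs2⟩ := hE.exists_isLUB h ⟨y, hy⟩ hchain.directedOn
        (fun a ha => (hD ha).1) (fun a ha => (hD ha).2.1)
      refine ⟨s, ⟨hs0, hs1, .of_approx fun ε hε => ?_⟩, hs.1⟩
      obtain ⟨a, ha, hlt⟩ := hs2 ε hε
      exact ⟨a, (hD ha).2.2, hlt⟩)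
    0 ⟨le_refl _, zero_le_one, fun ε hε => ⟨∅, 1, one_pos, by simpa using fun _ _ _ => hε⟩⟩
  by_cases hr : 1 - g = 0
  · rw [sub_eq_zero.1 hr]
    exact hg.prop.2.2
  exfalso
  have h0 : (0 : H →L[ℂ] H) ≤ ((1 - g : M.toStarSubalgebra) : H →L[ℂ] H) := by
    simpa using hg.prop.2.1
  have h1 : ((1 - g : M.toStarSubalgebra) : H →L[ℂ] H) ≤ 1 := by
    simpa using hg.prop.1
  obtain ⟨g', hg'0, hg'r, hg'ne, hg'⟩ := hE.exists_isStronglyContinuous_le h h0 h1 hr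
  have hmem : g + g' ∈ {g : M.toStarSubalgebra | 0 ≤ (g : H →L[ℂ] H) ∧ (g : H →L[ℂ] H) ≤ 1 ∧ hE.IsStronglyContinuous h g} := by
    refine ⟨add_nonneg hg.prop.1 hg'0, ?_, hg.prop.2.2.add hg'⟩
    have : (g' : H →L[ℂ] H) ≤ 1 - (g : H →L[ℂ] H) := hg'r
    have := add_le_add_right this (g : H →L[ℂ] H)
    simpa using this
  have h3 : ((g + g' : M.toStarSubalgebra) : H →L[ℂ] H) ≤ g :=
    hg.le_of_ge hmem (show (g : H →L[ℂ] H) ≤ (g : H →L[ℂ] H) + g' from le_add_of_nonneg_right hg'0)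
  have h4 : (g' : H →L[ℂ] H) ≤ 0 := by simpa using h3
  exact hg'ne (Subtype.ext (le_antisymm h4 hg'0))

end IsNormalFaithfulCondExp

end Density

/-! ### Density of a *-subalgebra in its bicommutant, and norms seen on GNS spaces. -/

section Resolvent

open Filter Topology
open scoped InnerProductSpace

variable {H : Type u} [NormedAddCommGroup H] [InnerProductSpace ℂ H] [CompleteSpace H]

/-- The resolvent `(1 + i t b)⁻¹` of a self-adjoint operator `b`. -/
noncomputable def imagResolvent (t : ℝ) (b : H →L[ℂ] H) : H →L[ℂ] H :=
  cfc (fun z : ℂ => (1 + Complex.I * t * z)⁻¹) b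

theorem one_add_I_mul_ne_zero (t : ℝ) {b : H →L[ℂ] H} (hb : IsSelfAdjoint b) {z : ℂ}
    (hz : z ∈ spectrum ℂ b) : 1 ≤ ‖1 + Complex.I * t * z‖ := by
  rw [hb.mem_spectrum_eq_re hz]
  have : (1 + Complex.I * t * (z.re : ℂ)).re = 1 := by simp
  calc (1 : ℝ) = |(1 + Complex.I * t * (z.re : ℂ)).re| := by rw [this, abs_one]
    _ ≤ _ := Complex.abs_re_le_norm _

theorem continuousOn_imagResolvent (t : ℝ) {b : H →L[ℂ] H} (hb : IsSelfAdjoint b) :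
    ContinuousOn (fun z : ℂ => (1 + Complex.I * t * z)⁻¹) (spectrum ℂ b) := by
  refine ContinuousOn.inv₀ (by fun_prop) fun z hz h0 => ?_
  have := one_add_I_mul_ne_zero t hb hz
  rw [h0, norm_zero] at this
  linarith

theorem cfc_one_add_I_mul (t : ℝ) {b : H →L[ℂ] H} (hb : IsSelfAdjoint b) :
    cfc (fun z : ℂ => 1 + Complex.I * t * z) b = 1 + (Complex.I * t) • b := by
  have := hb.isStarNormal
  rw [cfc_const_add (1 : ℂ) (fun z : ℂ => Complex.I * t * z) b,
    cfc_const_mul (Complex.I * t) (fun z : ℂ => z) b, cfc_id' ℂ b]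
  simp

theorem imagResolvent_mul (t : ℝ) {b : H →L[ℂ] H} (hb : IsSelfAdjoint b) :
    imagResolvent t b * (1 + (Complex.I * t) • b) = 1 := by
  have := hb.isStarNormal
  rw [← cfc_one_add_I_mul t hb, imagResolvent,
    ← cfc_mul _ _ b (continuousOn_imagResolvent t hb) (by fun_prop), ← cfc_one ℂ b]
  refine cfc_congr fun z hz => ?_
  have h1 := one_add_I_mul_ne_zero t hb hz
  exact inv_mul_cancel₀ (norm_pos_iff.1 (one_pos.trans_le h1))

theorem mul_imagResolvent (t : ℝ) {b : H →L[ℂ] H} (hb : IsSelfAdjoint b) :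
    (1 + (Complex.I * t) • b) * imagResolvent t b = 1 := by
  have h : Commute (1 + (Complex.I * t) • b) (imagResolvent t b) := by
    rw [← cfc_one_add_I_mul t hb]
    exact cfc_commute_cfc _ _ b
  rw [h.eq, imagResolvent_mul t hb]

theorem norm_imagResolvent_le (t : ℝ) {b : H →L[ℂ] H} (hb : IsSelfAdjoint b) :
    ‖imagResolvent t b‖ ≤ 1 := by
  refine norm_cfc_le zero_le_one fun z hz => ?_
  rw [norm_inv]
  exact inv_le_one_of_one_le₀ (one_add_I_mul_ne_zero t hb hz)

/-- In the resolvent identity `b` occurs only through a contraction and through `y - b` on the range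
of the resolvent of `y`. Closeness on a few vectors therefore suffices, with no bound on `‖b‖`. -/
theorem imagResolvent_sub (t : ℝ) {b y : H →L[ℂ] H} (hb : IsSelfAdjoint b) (hy : IsSelfAdjoint y) :
    imagResolvent t b - imagResolvent t y =
      imagResolvent t b * (((Complex.I * t) • (y - b)) * imagResolvent t y) := by
  have h : (Complex.I * t) • (y - b) = (1 + (Complex.I * t) • y) - (1 + (Complex.I * t) • b) := by
    rw [smul_sub]; abel
  rw [h, sub_mul, mul_imagResolvent t hy, mul_sub, mul_one, ← mul_assoc, imagResolvent_mul t hb,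
    one_mul]

namespace IsNormalFaithfulCondExp

variable {M N : VonNeumannAlgebra H} {E : M.toStarSubalgebra →ₗ[ℂ] N.toStarSubalgebra}

theorem cfc_mem_closure (S : StarSubalgebra ℂ M.toStarSubalgebra) (f : ℝ → ℝ) {b : M.toStarSubalgebra}
    (hb : b ∈ closure (S : Set M.toStarSubalgebra)) :
    cfc f (b : H →L[ℂ] H) ∈
      closure ((fun a : M.toStarSubalgebra => (a : H →L[ℂ] H)) '' (S : Set M.toStarSubalgebra)) := by
  have : IsClosed ((S.map M.toStarSubalgebra.subtype).topologicalClosure : Set (H →L[ℂ] H)) :=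
    isClosed_closure
  refine cfc_mem (s := (S.map M.toStarSubalgebra.subtype).topologicalClosure) f ?_
  exact closure_subtype.1 hb

theorem imagResolvent_mem_closure (S : StarSubalgebra ℂ M.toStarSubalgebra) (t : ℝ) {b : H →L[ℂ] H}
    (hb : b ∈ (S.map M.toStarSubalgebra.subtype)) :
    imagResolvent t b ∈
      closure ((fun a : M.toStarSubalgebra => (a : H →L[ℂ] H)) '' (S : Set M.toStarSubalgebra)) := by
  have : IsClosed ((S.map M.toStarSubalgebra.subtype).topologicalClosure : Set (H →L[ℂ] H)) :=
    isClosed_closure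
  exact cfc_mem (s := (S.map M.toStarSubalgebra.subtype).topologicalClosure) _
    (StarSubalgebra.le_topologicalClosure _ hb)

theorem mem_of_mem_closure_image {S : Set M.toStarSubalgebra} {x : H →L[ℂ] H}
    (hx : x ∈ closure ((fun a : M.toStarSubalgebra => (a : H →L[ℂ] H)) '' S)) : x ∈ M := by
  refine closure_minimal ?_ M.isClosed hx
  rintro _ ⟨a, -, rfl⟩
  exact a.2

theorem toGNS_mem_closure_of_mem_closure (hE : IsNormalFaithfulCondExp M N E) (h : H)
    {S : Set M.toStarSubalgebra} {x : M.toStarSubalgebra} (hx : x ∈ closure S) :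
    hE.toGNS h x ∈ closure (hE.toGNS h '' S) :=
  image_closure_subset_closure_image (hE.continuous_toGNS h) ⟨x, hx, rfl⟩

/-- The self-adjoint approximants of `y` may be unbounded in norm, but their resolvents are
contractions in the norm closure of `S`, so strong continuity on the unit ball applies to them. This
replaces Kaplansky's density theorem. -/
theorem toGNS_imagResolvent_mem_closure (hE : IsNormalFaithfulCondExp M N E) (h : H)
    (S : StarSubalgebra ℂ M.toStarSubalgebra) {y : H →L[ℂ] H} (hysa : IsSelfAdjoint y)
    (hy : y ∈ Set.centralizer (Set.centralizer
      ((S.map M.toStarSubalgebra.subtype : StarSubalgebra ℂ (H →L[ℂ] H)) : Set (H →L[ℂ] H))))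
    (t : ℝ) {u : M.toStarSubalgebra} (hu : (u : H →L[ℂ] H) = imagResolvent t y) :
    hE.toGNS h u ∈ closure (hE.toGNS h '' S) := by
  rw [← closure_closure, Metric.mem_closure_iff]
  intro ε hε
  obtain ⟨F, δ, hδ, hF⟩ := hE.isStronglyContinuous_one h (ε / 2) (half_pos hε)
  -- The approximation is required at the vectors `imagResolvent t y η`, where the resolvent
  -- identity needs it, not at `η`.
  obtain ⟨b, hb, hlim⟩ := exists_seq_selfAdjoint_tendsto_of_mem_bicommutant
    (S.map M.toStarSubalgebra.subtype) hy hysa (fun η : F => imagResolvent t y η)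
  have hδ' : 0 < δ / (|t| + 1) := div_pos hδ (by positivity)
  obtain ⟨n, hn⟩ := (eventually_all.2 fun η => (Metric.tendsto_nhds.1 (hlim η)) _ hδ').exists
  have hvcl := imagResolvent_mem_closure S t (hb n).1
  let v : M.toStarSubalgebra := ⟨imagResolvent t (b n), mem_of_mem_closure_image hvcl⟩
  refine ⟨hE.toGNS h v, hE.toGNS_mem_closure_of_mem_closure h (closure_subtype.2 hvcl), ?_⟩
  -- The factor `1 / 2` keeps the difference of two contractions in the unit ball.
  let c : M.toStarSubalgebra := (1 / 2 : ℂ) • (v - u)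
  have hc : (c : H →L[ℂ] H) = (1 / 2 : ℂ) • (imagResolvent t (b n) - imagResolvent t y) := by
    simp [c, v, hu]
  have h1 := hF c
    (by
      rw [hc, norm_smul]
      have := norm_sub_le (imagResolvent t (b n)) (imagResolvent t y)
      have h1 := norm_imagResolvent_le t (hb n).2
      have h2 := norm_imagResolvent_le t hysa
      norm_num
      linarith)
    (by
      intro η hη
      have h3 := hn ⟨η, hη⟩
      rw [dist_comm, dist_eq_norm] at h3
      set z := imagResolvent t y η
      have h4 : (c : H →L[ℂ] H) η =
          (1 / 2 : ℂ) • imagResolvent t (b n) ((Complex.I * t) • (y z - b n z)) := by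
        rw [hc, imagResolvent_sub t (hb n).2 hysa]
        rfl
      have h5 := (imagResolvent t (b n)).le_of_opNorm_le (norm_imagResolvent_le t (hb n).2)
        ((Complex.I * t) • (y z - b n z))
      rw [h4, norm_smul]
      rw [norm_smul, norm_mul, Complex.norm_I, one_mul, one_mul, Complex.norm_real, Real.norm_eq_abs] at h5
      have h6 : ‖(1 / 2 : ℂ)‖ ≤ 1 := by norm_num
      calc ‖(1 / 2 : ℂ)‖ * _ ≤ 1 * (|t| * ‖y z - b n z‖) := by gcongr
        _ ≤ (|t| + 1) * ‖y z - b n z‖ := by rw [one_mul]; gcongr; linarith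
        _ < (|t| + 1) * (δ / (|t| + 1)) := by gcongr
        _ = δ := by field_simp)
  rw [mul_one] at h1
  have h2 : hE.toGNS h v - hE.toGNS h u = (2 : ℂ) • hE.toGNS h c := by
    rw [← map_sub, ← map_smul]
    congr 1
    simp [c, smul_smul]
  rw [dist_comm, dist_eq_norm, h2, norm_smul, Complex.norm_ofNat]
  linarith

/-- The operator is recovered from its resolvents `u t`: `y * u t` is a multiple of `1 - u t` for `t
≠ 0`, and it converges to `y` in norm as `t → 0`, with error at most `t ‖y‖²`. -/
theorem toGNS_mem_closure_of_isSelfAdjoint (hE : IsNormalFaithfulCondExp M N E) (h : H)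
    (S : StarSubalgebra ℂ M.toStarSubalgebra) {y : M.toStarSubalgebra}
    (hysa : IsSelfAdjoint (y : H →L[ℂ] H))
    (hy : (y : H →L[ℂ] H) ∈ Set.centralizer (Set.centralizer
      ((S.map M.toStarSubalgebra.subtype : StarSubalgebra ℂ (H →L[ℂ] H)) : Set (H →L[ℂ] H)))) :
    hE.toGNS h y ∈ closure (hE.toGNS h '' S) := by
  have hMcl : IsClosed (M.toStarSubalgebra : Set (H →L[ℂ] H)) := M.isClosed
  let u : ℝ → M.toStarSubalgebra := fun t =>
    ⟨imagResolvent t (y : H →L[ℂ] H), cfc_mem (s := M.toStarSubalgebra) _ y.2⟩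
  let C : Submodule ℂ (hE.GNS h) :=
    (S.toSubalgebra.toSubmodule.map (hE.toGNS h).toLinearMap).topologicalClosure
  have hC : (C : Set (hE.GNS h)) = closure (hE.toGNS h '' S) := rfl
  have hu : ∀ t, hE.toGNS h (u t) ∈ C := fun t =>
    hE.toGNS_imagResolvent_mem_closure h S hysa hy t rfl
  have hone : hE.toGNS h 1 ∈ C := subset_closure ⟨1, one_mem S, rfl⟩
  have hyu : ∀ t : ℝ, (Complex.I * t) • (y * u t) = 1 - u t := by
    intro t
    apply Subtype.ext
    have := mul_imagResolvent t hysa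
    rw [add_mul, one_mul, smul_mul_assoc] at this
    exact eq_sub_of_add_eq' this
  have hmem : ∀ t : ℝ, t ≠ 0 → hE.toGNS h (y * u t) ∈ C := by
    intro t ht
    have h0 : Complex.I * t ≠ 0 := mul_ne_zero Complex.I_ne_zero (by exact_mod_cast ht)
    have : y * u t = (Complex.I * t)⁻¹ • (1 - u t) := by
      rw [← hyu, smul_smul, inv_mul_cancel₀ h0, one_smul]
    rw [this, map_smul, map_sub]
    exact C.smul_mem _ (C.sub_mem hone (hu t))
  have hlim : Tendsto (fun n : ℕ => y * u (1 / ((n : ℝ) + 1))) atTop (𝓝 y) := by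
    rw [tendsto_iff_norm_sub_tendsto_zero]
    have h0 : Tendsto (fun n : ℕ => (1 / ((n : ℝ) + 1)) * (‖y‖ * ‖y‖)) atTop (𝓝 0) := by
      simpa using tendsto_one_div_add_atTop_nhds_zero_nat.mul_const (‖y‖ * ‖y‖)
    refine squeeze_zero (fun _ => norm_nonneg _) (fun n => ?_) h0
    set t : ℝ := 1 / ((n : ℝ) + 1) with ht
    have ht0 : 0 < t := by positivity
    have h1 : y * u t - y = -(y * ((Complex.I * t) • (y * u t))) := by
      rw [hyu, mul_sub, mul_one]; abel
    have h2 : ‖u t‖ ≤ 1 := norm_imagResolvent_le t hysa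
    rw [h1, norm_neg]
    calc _ ≤ ‖y‖ * (‖(Complex.I * t : ℂ)‖ * (‖y‖ * ‖u t‖)) := by
            refine (norm_mul_le _ _).trans ?_
            rw [norm_smul]
            gcongr
            exact norm_mul_le _ _
      _ ≤ ‖y‖ * (t * (‖y‖ * 1)) := by
            rw [norm_mul, Complex.norm_I, one_mul, Complex.norm_real, Real.norm_eq_abs, abs_of_pos ht0]
            gcongr
      _ = _ := by ring
  have := ((hE.continuous_toGNS h).tendsto y).comp hlim
  rw [← hC]
  refine (Submodule.isClosed_topologicalClosure _).mem_of_tendsto this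
    (Eventually.of_forall fun n => hmem _ (by positivity))

/-- A *-subalgebra is dense in the von Neumann algebra that it generates, for the GNS norm. -/
theorem toGNS_mem_closure (hE : IsNormalFaithfulCondExp M N E) (h : H)
    (S : StarSubalgebra ℂ M.toStarSubalgebra) {P : VonNeumannAlgebra H}
    (hP : ∀ a ∈ P, a ∈ Set.centralizer (Set.centralizer
      ((S.map M.toStarSubalgebra.subtype : StarSubalgebra ℂ (H →L[ℂ] H)) : Set (H →L[ℂ] H))))
    {y : M.toStarSubalgebra} (hy : (y : H →L[ℂ] H) ∈ P) :
    hE.toGNS h y ∈ closure (hE.toGNS h '' S) := by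
  let C : Submodule ℂ (hE.GNS h) :=
    (S.toSubalgebra.toSubmodule.map (hE.toGNS h).toLinearMap).topologicalClosure
  have h1 : hE.toGNS h (y + star y) ∈ C :=
    hE.toGNS_mem_closure_of_isSelfAdjoint h S (IsSelfAdjoint.add_star_self (y : H →L[ℂ] H))
      (hP _ (add_mem hy (star_mem hy)))
  have h2 : hE.toGNS h (Complex.I • (y - star y)) ∈ C := by
    refine hE.toGNS_mem_closure_of_isSelfAdjoint h S (y := Complex.I • (y - star y)) ?_ (hP _ ?_)
    · change star (Complex.I • ((y : H →L[ℂ] H) - star (y : H →L[ℂ] H))) = _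
      rw [star_smul, star_sub, star_star, Complex.star_def, Complex.conj_I]
      change _ = Complex.I • ((y : H →L[ℂ] H) - star (y : H →L[ℂ] H))
      module
    · exact P.toStarSubalgebra.smul_mem (show (y : H →L[ℂ] H) - star (y : H →L[ℂ] H) ∈ P from
        sub_mem hy (star_mem hy)) _
  have h3 : y = (1 / 2 : ℂ) • (y + star y) + (-Complex.I / 2) • (Complex.I • (y - star y)) := by
    rw [smul_smul]
    have : -Complex.I / 2 * Complex.I = 1 / 2 := by
      rw [div_mul_eq_mul_div, neg_mul, Complex.I_mul_I, neg_neg]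
    rw [this]
    module
  change hE.toGNS h y ∈ C
  rw [h3, map_add, map_smul, map_smul]
  exact C.add_mem (C.smul_mem _ h1) (C.smul_mem _ h2)

/-- The operator norm on the closure of a *-subalgebra is determined by the actions on the GNS
images of that subalgebra. -/
theorem norm_le_of_norm_toGNS_mul_le (hE : IsNormalFaithfulCondExp M N E)
    (S : StarSubalgebra ℂ M.toStarSubalgebra) {x : M.toStarSubalgebra}
    (hx : x ∈ closure (S : Set M.toStarSubalgebra)) {C : ℝ} (hC : 0 ≤ C)
    (hb : ∀ h, ∀ u ∈ S, ‖hE.toGNS h (x * u)‖ ≤ C * ‖hE.toGNS h u‖) :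
    ‖(x : H →L[ℂ] H)‖ ≤ C := by
  have hb' : ∀ h, ∀ u ∈ closure (S : Set M.toStarSubalgebra),
      ‖hE.toGNS h (x * u)‖ ≤ C * ‖hE.toGNS h u‖ := by
    intro h u hu
    have hcl : IsClosed {u | ‖hE.toGNS h (x * u)‖ ≤ C * ‖hE.toGNS h u‖} :=
      isClosed_le ((hE.continuous_toGNS h).comp (continuous_const.mul continuous_id)).norm
        (continuous_const.mul (hE.continuous_toGNS h).norm)
    exact closure_minimal (hb h) hcl hu
  let b : M.toStarSubalgebra := star x * x
  have hbS : b ∈ closure (S : Set M.toStarSubalgebra) :=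
    mul_mem (S := StarSubalgebra ℂ M.toStarSubalgebra) (s := S.topologicalClosure) (star_mem hx) hx
  have hbsa : IsSelfAdjoint (b : H →L[ℂ] H) := .star_mul_self (x : H →L[ℂ] H)
  -- Spectral cut-off above `C²`: with `b = star x * x`, `f = (b - C²)₊` and `q = √f`, one has `q b
  -- q - C² q² = f²`. Applying the hypothesis to `q` makes the GNS norm of `f` vanish for every `h`,
  -- so `f = 0` and `b ≤ C²`.
  let f : ℝ → ℝ := fun t => max (t - C ^ 2) 0
  let g : ℝ → ℝ := fun t => √(max (t - C ^ 2) 0)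
  have hf := cfc_mem_closure S f hbS
  have hg := cfc_mem_closure S g hbS
  let a : M.toStarSubalgebra := ⟨cfc f (b : H →L[ℂ] H), mem_of_mem_closure_image hf⟩
  let q : M.toStarSubalgebra := ⟨cfc g (b : H →L[ℂ] H), mem_of_mem_closure_image hg⟩
  have hq : q ∈ closure (S : Set M.toStarSubalgebra) := closure_subtype.2 hg
  have hqsa : star q = q := Subtype.ext (cfc_predicate g (b : H →L[ℂ] H)).star_eq
  have hasa : star a = a := Subtype.ext (cfc_predicate f (b : H →L[ℂ] H)).star_eq
  have hkey : q * b * q - ((C ^ 2 : ℝ) : ℂ) • (q * q) = star a * a := by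
    rw [hasa]
    apply Subtype.ext
    change cfc g (b : H →L[ℂ] H) * b * cfc g (b : H →L[ℂ] H) -
      ((C ^ 2 : ℝ) : ℂ) • (cfc g (b : H →L[ℂ] H) * cfc g (b : H →L[ℂ] H)) =
      cfc f (b : H →L[ℂ] H) * cfc f (b : H →L[ℂ] H)
    have hid : (b : H →L[ℂ] H) = cfc (fun t : ℝ => t) (b : H →L[ℂ] H) := (cfc_id' ℝ _).symm
    conv_lhs => enter [1, 1, 2]; rw [hid]
    rw [← cfc_mul .., ← cfc_mul .., ← cfc_mul .., ← cfc_mul .., Complex.coe_smul,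
      ← cfc_const_mul .., ← cfc_sub ..]
    refine cfc_congr fun t _ => ?_
    have h1 : g t * g t = f t := Real.mul_self_sqrt (le_max_right _ _)
    change g t * t * g t - C ^ 2 * (g t * g t) = f t * f t
    have h2 : f t * (t - C ^ 2) = f t * f t := by
      rcases le_total (t - C ^ 2) 0 with h | h
      · simp [f, h]
      · simp [f, h]
    linear_combination (t - C ^ 2) * h1 + h2
  have ha0 : a = 0 := by
    refine hE.eq_zero_of_norm_toGNS fun h => ?_
    have h1 := pow_le_pow_left₀ (norm_nonneg _) (hb' h q hq) 2
    rw [mul_pow, norm_toGNS_sq, norm_toGNS_sq] at h1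
    have h2 := hE.norm_toGNS_sq h a
    rw [← hkey, map_sub, map_smul] at h2
    have h3 : star (x * q) * (x * q) = q * b * q := by
      rw [star_mul, hqsa]; simp only [b, mul_assoc]
    rw [h3, hqsa] at h1
    have h4 : ‖hE.toGNS h a‖ ^ 2 ≤ 0 := by
      rw [h2]
      simp only [AddSubgroupClass.coe_sub, sub_apply, inner_sub_right, Complex.sub_re,
        SetLike.val_smul, smul_apply, inner_smul_right, Complex.re_ofReal_mul]
      linarith
    exact pow_eq_zero_iff two_ne_zero |>.1 (le_antisymm h4 (sq_nonneg _))
  have hle : (b : H →L[ℂ] H) ≤ algebraMap ℝ (H →L[ℂ] H) (C ^ 2) := by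
    have h1 : cfc (fun t : ℝ => t - C ^ 2) (b : H →L[ℂ] H) ≤ cfc f (b : H →L[ℂ] H) :=
      cfc_mono fun t _ => le_max_left _ _
    have h2 : cfc f (b : H →L[ℂ] H) = 0 := congrArg Subtype.val ha0
    rw [h2, cfc_sub .., cfc_id' ℝ (b : H →L[ℂ] H), cfc_const .., sub_nonpos] at h1
    exact h1
  have hn := (CStarAlgebra.norm_le_iff_le_algebraMap (b : H →L[ℂ] H) (sq_nonneg C)
    (star_mul_self_nonneg (x : H →L[ℂ] H))).2 hle
  have h5 : ‖(b : H →L[ℂ] H)‖ = ‖(x : H →L[ℂ] H)‖ * ‖(x : H →L[ℂ] H)‖ :=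
    CStarRing.norm_star_mul_self (x := (x : H →L[ℂ] H))
  rw [h5, ← sq] at hn
  exact le_of_sq_le_sq hn hC

end IsNormalFaithfulCondExp

end Resolvent

/-! ### The calculus of reduced words. -/

section Words

open scoped InnerProductSpace

variable {H : Type u} [NormedAddCommGroup H] [InnerProductSpace ℂ H] [CompleteSpace H]
variable {M N : VonNeumannAlgebra H} {A : ℕ → VonNeumannAlgebra H}
  {E : M.toStarSubalgebra →ₗ[ℂ] N.toStarSubalgebra}

theorem wordProd_nil : wordProd ([] : List (ℕ × M.toStarSubalgebra)) = 1 := rfl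

theorem wordProd_cons (p : ℕ × M.toStarSubalgebra) (w : List (ℕ × M.toStarSubalgebra)) :
    wordProd (p :: w) = p.2 * wordProd w := by
  simp [wordProd]

theorem wordProd_append (w₁ w₂ : List (ℕ × M.toStarSubalgebra)) :
    wordProd (w₁ ++ w₂) = wordProd w₁ * wordProd w₂ := by
  simp [wordProd]

/-- The adjoint of a word. -/
noncomputable def wordStar (w : List (ℕ × M.toStarSubalgebra)) : List (ℕ × M.toStarSubalgebra) :=
  (w.map fun p => (p.1, star p.2)).reverse

theorem wordStar_cons (p : ℕ × M.toStarSubalgebra) (w : List (ℕ × M.toStarSubalgebra)) :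
    wordStar (p :: w) = wordStar w ++ [(p.1, star p.2)] := by
  simp [wordStar]

theorem map_fst_wordStar (w : List (ℕ × M.toStarSubalgebra)) :
    (wordStar w).map Prod.fst = (w.map Prod.fst).reverse := by
  simp [wordStar, List.map_reverse, Function.comp_def]

theorem wordProd_wordStar (w : List (ℕ × M.toStarSubalgebra)) :
    wordProd (wordStar w) = star (wordProd w) := by
  induction w with
  | nil => simp [wordStar, wordProd]
  | cons p w ih => rw [wordStar_cons, wordProd_append, ih, wordProd_cons, wordProd_cons, wordProd_nil, star_mul, mul_one]

namespace IsReducedWord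

theorem nil : IsReducedWord A E [] := ⟨.nil, by simp, by simp⟩

theorem append_iff {w₁ w₂ : List (ℕ × M.toStarSubalgebra)} :
    IsReducedWord A E (w₁ ++ w₂) ↔ IsReducedWord A E w₁ ∧ IsReducedWord A E w₂ ∧
      ((w₁ ++ w₂).map Prod.fst).IsChain (· ≠ ·) := by
  constructor
  · rintro ⟨h1, h2, h3⟩
    have h1' := h1
    rw [List.map_append] at h1'
    exact ⟨⟨h1'.left_of_append, fun p hp => h2 p (by simp [hp]), fun p hp => h3 p (by simp [hp])⟩,
      ⟨h1'.right_of_append, fun p hp => h2 p (by simp [hp]), fun p hp => h3 p (by simp [hp])⟩, h1⟩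
  · rintro ⟨h1, h2, h3⟩
    refine ⟨h3, fun p hp => ?_, fun p hp => ?_⟩
    · rcases List.mem_append.1 hp with h | h
      exacts [h1.mem p h, h2.mem p h]
    · rcases List.mem_append.1 hp with h | h
      exacts [h1.meanZero p h, h2.meanZero p h]

theorem cons_iff {p : ℕ × M.toStarSubalgebra} {w : List (ℕ × M.toStarSubalgebra)} :
    IsReducedWord A E (p :: w) ↔ (p.2 : H →L[ℂ] H) ∈ A p.1 ∧ E p.2 = 0 ∧ IsReducedWord A E w ∧
      ((p :: w).map Prod.fst).IsChain (· ≠ ·) := by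
  have h : IsReducedWord A E [p] ↔ (p.2 : H →L[ℂ] H) ∈ A p.1 ∧ E p.2 = 0 :=
    ⟨fun h => ⟨h.mem p (by simp), h.meanZero p (by simp)⟩,
      fun h => ⟨by simp, by simpa using h.1, by simpa using h.2⟩⟩
  rw [← List.singleton_append, append_iff, h, and_assoc]

theorem replace {w₁ w₂ : List (ℕ × M.toStarSubalgebra)} {i : ℕ} {b c : M.toStarSubalgebra}
    (h : IsReducedWord A E (w₁ ++ (i, b) :: w₂)) (hc : (c : H →L[ℂ] H) ∈ A i) (hc0 : E c = 0) :
    IsReducedWord A E (w₁ ++ (i, c) :: w₂) := by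
  rw [append_iff, cons_iff] at h ⊢
  have h1 := h.2.1.2.2.2
  have h2 := h.2.2
  simp only [List.map_append, List.map_cons] at h1 h2 ⊢
  exact ⟨h.1, ⟨hc, hc0, h.2.1.2.2.1, h1⟩, h2⟩

end IsReducedWord

/-- The span of the products `n * a₁ ⋯ a_m`, with `n ∈ N` and `a₁ ⋯ a_m` a reduced word whose
sequence of indices belongs to `S`. -/
noncomputable def wordSpan (A : ℕ → VonNeumannAlgebra H)
    (E : M.toStarSubalgebra →ₗ[ℂ] N.toStarSubalgebra) (S : Set (List ℕ)) :
    Submodule ℂ M.toStarSubalgebra :=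
  Submodule.span ℂ {a | ∃ n : M.toStarSubalgebra, (n : H →L[ℂ] H) ∈ N ∧
    ∃ w, IsReducedWord A E w ∧ w.map Prod.fst ∈ S ∧ a = n * wordProd w}

theorem wordSpan_mono {S T : Set (List ℕ)} (h : S ⊆ T) : wordSpan A E S ≤ wordSpan A E T :=
  Submodule.span_mono fun _ ⟨n, hn, w, hw, hS, ha⟩ => ⟨n, hn, w, hw, h hS, ha⟩

theorem mul_wordProd_mem_wordSpan {S : Set (List ℕ)} {n : M.toStarSubalgebra}
    (hn : (n : H →L[ℂ] H) ∈ N) {w} (hw : IsReducedWord A E w) (hS : w.map Prod.fst ∈ S) :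
    n * wordProd w ∈ wordSpan A E S :=
  Submodule.subset_span ⟨n, hn, w, hw, hS, rfl⟩

theorem wordProd_mem_wordSpan {S : Set (List ℕ)} {w} (hw : IsReducedWord A E w)
    (hS : w.map Prod.fst ∈ S) : wordProd w ∈ wordSpan A E S := by
  have := mul_wordProd_mem_wordSpan (n := 1) (one_mem N) hw hS
  rwa [one_mul] at this

theorem wordSpan_union (S T : Set (List ℕ)) :
    wordSpan A E (S ∪ T) ≤ wordSpan A E S ⊔ wordSpan A E T := by
  refine Submodule.span_le.2 ?_
  rintro _ ⟨n, hn, w, hw, hS | hT, rfl⟩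
  · exact Submodule.mem_sup_left (mul_wordProd_mem_wordSpan hn hw hS)
  · exact Submodule.mem_sup_right (mul_wordProd_mem_wordSpan hn hw hT)

theorem wordSpan_univ_le_iSup : wordSpan A E Set.univ ≤ ⨆ l, wordSpan A E {l} := by
  refine Submodule.span_le.2 ?_
  rintro _ ⟨n, hn, w, hw, -, rfl⟩
  exact Submodule.mem_iSup_of_mem (w.map Prod.fst) (mul_wordProd_mem_wordSpan hn hw rfl)

namespace IsReducedFreeProduct

variable (hF : IsReducedFreeProduct M N A E)
include hF

/-- The conditional expectation, with values in `M`. -/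
noncomputable def mean (hF : IsReducedFreeProduct M N A E) (a : M.toStarSubalgebra) :
    M.toStarSubalgebra := ⟨(E a : H →L[ℂ] H), hF.condExp.le (E a).2⟩

theorem mean_mem (a : M.toStarSubalgebra) : (hF.mean a : H →L[ℂ] H) ∈ N := (E a).2

theorem apply_mean (a : M.toStarSubalgebra) : E (hF.mean a) = E a :=
  Subtype.ext (hF.condExp.apply_of_mem _ (hF.mean_mem a))

theorem sub_mean_mem {i : ℕ} {a : M.toStarSubalgebra} (ha : (a : H →L[ℂ] H) ∈ A i) :
    ((a - hF.mean a : M.toStarSubalgebra) : H →L[ℂ] H) ∈ A i :=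
  show (a : H →L[ℂ] H) - (hF.mean a : H →L[ℂ] H) ∈ A i from
    sub_mem ha (hF.base_le i (hF.mean_mem a))

theorem apply_sub_mean (a : M.toStarSubalgebra) : E (a - hF.mean a) = 0 := by
  rw [map_sub, hF.apply_mean, sub_self]

theorem apply_mul_mul_eq_zero {n a n' : M.toStarSubalgebra} (hn : (n : H →L[ℂ] H) ∈ N)
    (hn' : (n' : H →L[ℂ] H) ∈ N) (ha : E a = 0) : E (n * a * n') = 0 := by
  apply Subtype.ext
  rw [hF.condExp.bimodule n a n' hn hn', ha]
  simp

theorem apply_mul_eq_zero {n a : M.toStarSubalgebra} (hn : (n : H →L[ℂ] H) ∈ N) (ha : E a = 0) :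
    E (n * a) = 0 := by
  have := hF.apply_mul_mul_eq_zero (n' := 1) hn (one_mem N) ha
  rwa [mul_one] at this

theorem apply_mul_eq_zero' {n a : M.toStarSubalgebra} (hn : (n : H →L[ℂ] H) ∈ N) (ha : E a = 0) :
    E (a * n) = 0 := by
  have := hF.apply_mul_mul_eq_zero (n := 1) (one_mem N) hn ha
  rwa [one_mul] at this

theorem apply_star_mul_eq_zero_comm {a b : M.toStarSubalgebra} (h : E (star a * b) = 0) :
    E (star b * a) = 0 := by
  apply Subtype.ext
  rw [← hF.condExp.map_star_mul, h]
  simp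

theorem apply_star_eq_zero {a : M.toStarSubalgebra} (h : E a = 0) : E (star a) = 0 := by
  have := hF.apply_star_mul_eq_zero_comm (a := 1) (b := a) (by rwa [star_one, one_mul])
  rwa [mul_one] at this

theorem isReducedWord_wordStar {w : List (ℕ × M.toStarSubalgebra)} (hw : IsReducedWord A E w) :
    IsReducedWord A E (wordStar w) := by
  refine ⟨?_, fun p hp => ?_, fun p hp => ?_⟩
  · rw [map_fst_wordStar, List.isChain_reverse]
    exact hw.isChain.imp fun _ _ h => h.symm
  · simp only [wordStar, List.mem_reverse, List.mem_map] at hp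
    obtain ⟨q, hq, rfl⟩ := hp
    exact star_mem (hw.mem q hq)
  · simp only [wordStar, List.mem_reverse, List.mem_map] at hp
    obtain ⟨q, hq, rfl⟩ := hp
    exact hF.apply_star_eq_zero (hw.meanZero q hq)

theorem wordProd_mul_mem_wordSpan {S : Set (List ℕ)} {w} (hw : IsReducedWord A E w)
    (hS : w.map Prod.fst ∈ S) {n : M.toStarSubalgebra} (hn : (n : H →L[ℂ] H) ∈ N) :
    wordProd w * n ∈ wordSpan A E S := by
  rcases List.eq_nil_or_concat' w with rfl | ⟨w, ⟨i, b⟩, rfl⟩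
  · have := mul_wordProd_mem_wordSpan (A := A) (E := E) (S := S) hn .nil hS
    rwa [wordProd_nil, mul_one] at this
  · have hb := (IsReducedWord.cons_iff.1 (IsReducedWord.append_iff.1 hw).2.1)
    have h1 : IsReducedWord A E (w ++ [(i, b * n)]) :=
      hw.replace (show (b : H →L[ℂ] H) * (n : H →L[ℂ] H) ∈ A i from mul_mem hb.1 (hF.base_le i hn))
        (hF.apply_mul_eq_zero' hn hb.2.1)
    have h2 : wordProd (w ++ [(i, b)]) * n = wordProd (w ++ [(i, b * n)]) := by
      simp only [wordProd_append, wordProd_cons, wordProd_nil, mul_one, mul_assoc]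
    rw [h2]
    refine wordProd_mem_wordSpan h1 ?_
    simpa using hS

omit hF in
theorem mul_mem_wordSpan {S : Set (List ℕ)} {n x : M.toStarSubalgebra}
    (hn : (n : H →L[ℂ] H) ∈ N) (hx : x ∈ wordSpan A E S) : n * x ∈ wordSpan A E S := by
  induction hx using Submodule.span_induction with
  | mem x hx =>
    obtain ⟨n', hn', w, hw, hS, rfl⟩ := hx
    rw [← mul_assoc]
    exact mul_wordProd_mem_wordSpan (show (n : H →L[ℂ] H) * (n' : H →L[ℂ] H) ∈ N from mul_mem hn hn') hw hS
  | zero => rw [mul_zero]; exact zero_mem _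
  | add x y _ _ hx hy => rw [mul_add]; exact add_mem hx hy
  | smul c x _ hx => rw [mul_smul_comm]; exact Submodule.smul_mem _ _ hx

/-- Products of reduced words with different sequences of indices have mean zero. -/
theorem apply_star_wordProd_mul_eq_zero {w' : List (ℕ × M.toStarSubalgebra)} :
    ∀ {w : List (ℕ × M.toStarSubalgebra)} {n : M.toStarSubalgebra}, IsReducedWord A E w' →
      IsReducedWord A E w → (n : H →L[ℂ] H) ∈ N → w'.map Prod.fst ≠ w.map Prod.fst →
      E (star (wordProd w') * (n * wordProd w)) = 0 := by
  induction w' with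
  | nil =>
    intro w n _ hw hn hne
    rw [wordProd_nil, star_one, one_mul]
    exact hF.apply_mul_eq_zero hn (hF.free w (by rintro rfl; exact hne rfl) hw)
  | cons p' t' ih =>
    obtain ⟨i', b'⟩ := p'
    intro w n hw' hw hn hne
    cases w with
    | nil =>
      rw [wordProd_nil, mul_one]
      exact hF.apply_mul_eq_zero' hn (hF.apply_star_eq_zero (hF.free _ (by simp) hw'))
    | cons p t =>
      obtain ⟨i, a⟩ := p
      have hw'' := hF.isReducedWord_wordStar hw'
      rw [wordStar_cons] at hw''
      have hb' := (IsReducedWord.cons_iff.1 hw')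
      have ha := (IsReducedWord.cons_iff.1 hw)
      by_cases hii : i = i'
      · subst hii
        -- The two adjacent letters merge. Their centred part leaves a nonempty reduced word, of
        -- mean zero. Their mean lies in `N` and leaves the two tails, whose index sequences still
        -- differ, so induction applies.
        set c : M.toStarSubalgebra := star b' * n * a with hc
        have hcA : (c : H →L[ℂ] H) ∈ A i :=
          mul_mem (mul_mem (star_mem hb'.1) (hF.base_le i hn)) ha.1
        have h1 : star (wordProd ((i, b') :: t')) * (n * wordProd ((i, a) :: t)) =
            wordProd (wordStar t' ++ (i, c - hF.mean c) :: t) +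
              star (wordProd t') * (hF.mean c * wordProd t) := by
          simp only [wordProd_append, wordProd_cons, wordProd_wordStar, star_mul, sub_mul, mul_sub]
          rw [hc]
          simp only [mul_assoc, sub_add_cancel]
        have h2 : IsReducedWord A E (wordStar t' ++ (i, c - hF.mean c) :: t) := by
          rw [IsReducedWord.append_iff, IsReducedWord.cons_iff]
          refine ⟨(IsReducedWord.append_iff.1 hw'').1, ⟨hF.sub_mean_mem hcA, hF.apply_sub_mean c,
            ha.2.2.1, by simpa using ha.2.2.2⟩, ?_⟩
          have h3 := hw''.isChain
          have h4 := hw.isChain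
          simp only [List.map_append, List.map_cons, List.map_nil] at h3 h4 ⊢
          rw [List.isChain_append] at h3 ⊢
          refine ⟨h3.1, h4, ?_⟩
          simpa using h3.2.2
        rw [h1, map_add, hF.free _ (by simp) h2, zero_add]
        exact ih hb'.2.2.1 ha.2.2.1 (hF.mean_mem c) fun h => hne (by simp [h])
      · have h1 : star (wordProd ((i', b') :: t')) * (n * wordProd ((i, a) :: t)) =
            wordProd (wordStar ((i', b') :: t') ++ (i, n * a) :: t) := by
          simp only [wordProd_append, wordProd_wordStar, wordProd_cons, mul_assoc]
        rw [h1]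
        refine hF.free _ (by simp) ?_
        rw [IsReducedWord.append_iff, IsReducedWord.cons_iff]
        refine ⟨hF.isReducedWord_wordStar hw', ⟨mul_mem (hF.base_le i hn) ha.1,
          hF.apply_mul_eq_zero hn ha.2.1, ha.2.2.1, by simpa using ha.2.2.2⟩, ?_⟩
        have h3 := hw''.isChain
        have h4 := hw.isChain
        rw [wordStar_cons]
        simp only [List.map_append, List.map_cons, List.map_nil] at h3 h4 ⊢
        rw [List.isChain_append]
        refine ⟨h3, h4, ?_⟩
        simpa using fun h => hii h.symm

theorem inner_toGNS_eq_zero_of_wordSpan (h : H) {S T : Set (List ℕ)} (hST : Disjoint S T)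
    {x y : M.toStarSubalgebra} (hx : x ∈ wordSpan A E S) (hy : y ∈ wordSpan A E T) :
    ⟪hF.condExp.toGNS h x, hF.condExp.toGNS h y⟫_ℂ = 0 := by
  induction hx using Submodule.span_induction with
  | mem x hx =>
    induction hy using Submodule.span_induction with
    | mem y hy =>
      obtain ⟨n', hn', w', hw', hS, rfl⟩ := hx
      obtain ⟨n, hn, w, hw, hT, rfl⟩ := hy
      have h1 : star (n' * wordProd w') * (n * wordProd w) =
          star (wordProd w') * ((star n' * n) * wordProd w) := by
        simp only [star_mul, mul_assoc]
      rw [IsNormalFaithfulCondExp.inner_toGNS, h1, hF.apply_star_wordProd_mul_eq_zero hw' hw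
        (show star (n' : H →L[ℂ] H) * (n : H →L[ℂ] H) ∈ N from mul_mem (star_mem hn') hn)
        (fun h => Set.disjoint_left.1 hST hS (h ▸ hT))]
      simp
    | zero => simp
    | add x y _ _ hx hy => rw [map_add, inner_add_right, hx, hy, add_zero]
    | smul c x _ hx => rw [map_smul, inner_smul_right, hx, mul_zero]
  | zero => simp
  | add x y _ _ hx hy => rw [map_add, inner_add_left, hx, hy, add_zero]
  | smul c x _ hx => rw [map_smul, inner_smul_left, hx, mul_zero]

/-- After merging with a first letter of the same index, if there is one, the factor splits into a
centred letter, which can be prefixed, and a mean in `N`. -/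
theorem letter_mul_mem_wordSpan {I : Set ℕ} {i : ℕ} (hi : i ∈ I) {a x : M.toStarSubalgebra}
    (ha : (a : H →L[ℂ] H) ∈ A i) (hx : x ∈ wordSpan A E {l | ∀ j ∈ l, j ∈ I}) :
    a * x ∈ wordSpan A E {l | ∀ j ∈ l, j ∈ I} := by
  induction hx using Submodule.span_induction with
  | mem x hx =>
    obtain ⟨n, hn, w, hw, hS, rfl⟩ := hx
    have key : ∀ (c : M.toStarSubalgebra) (w : List (ℕ × M.toStarSubalgebra)),
        (c : H →L[ℂ] H) ∈ A i → IsReducedWord A E w → (∀ j ∈ w.map Prod.fst, j ∈ I) →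
        ((i :: w.map Prod.fst).IsChain (· ≠ ·)) →
        c * wordProd w ∈ wordSpan A E {l | ∀ j ∈ l, j ∈ I} := by
      intro c w hc hw hS hch
      have h1 : IsReducedWord A E ((i, c - hF.mean c) :: w) := by
        rw [IsReducedWord.cons_iff]
        exact ⟨hF.sub_mean_mem hc, hF.apply_sub_mean c, hw, by simpa using hch⟩
      have h2 : c * wordProd w = wordProd ((i, c - hF.mean c) :: w) + hF.mean c * wordProd w := by
        rw [wordProd_cons, sub_mul, sub_add_cancel]
      rw [h2]
      refine add_mem (wordProd_mem_wordSpan h1 ?_) (mul_wordProd_mem_wordSpan (hF.mean_mem c) hw hS)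
      intro j hj
      rw [List.map_cons, List.mem_cons] at hj
      rcases hj with rfl | hj
      exacts [hi, hS j hj]
    rw [← mul_assoc]
    have hc : ((a * n : M.toStarSubalgebra) : H →L[ℂ] H) ∈ A i := mul_mem ha (hF.base_le i hn)
    cases w with
    | nil => exact key _ [] hc .nil (by simp) (by simp)
    | cons p t =>
      obtain ⟨j, b⟩ := p
      by_cases hij : i = j
      · subst hij
        rw [wordProd_cons, ← mul_assoc]
        have hb := IsReducedWord.cons_iff.1 hw
        exact key _ t (mul_mem hc hb.1) hb.2.2.1 (fun j hj => hS j (by simp only [List.map_cons, List.mem_cons]; exact Or.inr hj))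
          (by simpa using hb.2.2.2)
      · refine key _ _ hc hw hS ?_
        have := hw.isChain
        simp only [List.map_cons] at this ⊢
        exact List.IsChain.cons_cons hij this
  | zero => rw [mul_zero]; exact zero_mem _
  | add x y _ _ hx hy => rw [mul_add]; exact add_mem hx hy
  | smul c x _ hx => rw [mul_smul_comm]; exact Submodule.smul_mem _ _ hx

omit hF in
/-- The *-algebra generated by the algebras with index in `I`. -/
noncomputable def wordAlgebra (_ : IsReducedFreeProduct M N A E) (I : Set ℕ) :
    StarSubalgebra ℂ M.toStarSubalgebra :=
  StarAlgebra.adjoin ℂ {a | ∃ i ∈ I, (a : H →L[ℂ] H) ∈ A i}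

theorem mem_wordAlgebra {I : Set ℕ} {i : ℕ} (hi : i ∈ I) {a : M.toStarSubalgebra}
    (ha : (a : H →L[ℂ] H) ∈ A i) : a ∈ hF.wordAlgebra I :=
  StarAlgebra.subset_adjoin ℂ _ ⟨i, hi, ha⟩

theorem wordProd_mem_wordAlgebra {I : Set ℕ} {w} (hw : IsReducedWord A E w)
    (hI : ∀ j ∈ w.map Prod.fst, j ∈ I) : wordProd w ∈ hF.wordAlgebra I := by
  induction w with
  | nil => exact one_mem _
  | cons p t ih =>
    rw [wordProd_cons]
    have hp := IsReducedWord.cons_iff.1 hw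
    exact mul_mem (hF.mem_wordAlgebra (hI p.1 (by simp)) hp.1)
      (ih hp.2.2.1 fun j hj => hI j (by simp only [List.map_cons, List.mem_cons]; exact Or.inr hj))

theorem wordAlgebra_le_wordSpan {I : Set ℕ} {x : M.toStarSubalgebra} (hx : x ∈ hF.wordAlgebra I) :
    x ∈ wordSpan A E {l | ∀ j ∈ l, j ∈ I} := by
  suffices h : ∀ x ∈ hF.wordAlgebra I, ∀ y ∈ wordSpan A E {l | ∀ j ∈ l, j ∈ I},
      x * y ∈ wordSpan A E {l | ∀ j ∈ l, j ∈ I} by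
    have := h x hx 1 (wordProd_mem_wordSpan (w := []) .nil (by simp))
    rwa [mul_one] at this
  intro x hx
  have hx' : x ∈ Algebra.adjoin ℂ ({a : M.toStarSubalgebra | ∃ i ∈ I, (a : H →L[ℂ] H) ∈ A i} ∪
      star {a : M.toStarSubalgebra | ∃ i ∈ I, (a : H →L[ℂ] H) ∈ A i}) := by
    rw [← StarAlgebra.adjoin_toSubalgebra]
    exact hx
  clear hx
  induction hx' using Algebra.adjoin_induction with
  | mem a ha =>
    rcases ha with ⟨i, hi, ha⟩ | ⟨i, hi, ha⟩
    · exact fun y hy => hF.letter_mul_mem_wordSpan hi ha hy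
    · have ha' : (a : H →L[ℂ] H) ∈ A i := by
        have := star_mem (S := VonNeumannAlgebra H) ha
        simpa using this
      exact fun y hy => hF.letter_mul_mem_wordSpan hi ha' hy
  | algebraMap r =>
    intro y hy
    rw [Algebra.algebraMap_eq_smul_one, smul_mul_assoc, one_mul]
    exact Submodule.smul_mem _ _ hy
  | add a b _ _ ha hb =>
    intro y hy
    rw [add_mul]
    exact add_mem (ha y hy) (hb y hy)
  | mul a b _ _ ha hb =>
    intro y hy
    rw [mul_assoc]
    exact ha _ (hb y hy)

end IsReducedFreeProduct

end Words

/-! ### Truncation to a subset of indices, and the words occurring in martingale differences. -/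

section Truncation

open Filter Topology
open scoped InnerProductSpace

variable {H : Type u} [NormedAddCommGroup H] [InnerProductSpace ℂ H] [CompleteSpace H]
variable {M N : VonNeumannAlgebra H} {A : ℕ → VonNeumannAlgebra H}
  {E : M.toStarSubalgebra →ₗ[ℂ] N.toStarSubalgebra}

theorem List.exists_eq_append_cons_of_exists_not {α : Type*} {P : α → Prop} {l : List α}
    (h : ∃ x ∈ l, ¬ P x) : ∃ l₁ y l₂, l = l₁ ++ y :: l₂ ∧ (∀ x ∈ l₁, P x) ∧ ¬ P y := by
  induction l with
  | nil => simp at h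
  | cons a l ih =>
    by_cases ha : P a
    · obtain ⟨x, hx, hPx⟩ := h
      have hxl : x ∈ l := by
        rcases List.mem_cons.1 hx with rfl | h
        exacts [absurd ha hPx, h]
      obtain ⟨l₁, y, l₂, rfl, h1, h2⟩ := ih ⟨x, hxl, hPx⟩
      exact ⟨a :: l₁, y, l₂, rfl, by simpa [ha] using h1, h2⟩
    · exact ⟨[], a, l, rfl, by simp, ha⟩

theorem List.exists_eq_append_cons_of_exists_not' {α : Type*} {P : α → Prop} {l : List α}
    (h : ∃ x ∈ l, ¬ P x) : ∃ l₁ y l₂, l = l₁ ++ y :: l₂ ∧ (∀ x ∈ l₂, P x) ∧ ¬ P y := by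
  obtain ⟨l₁, y, l₂, h1, h2, h3⟩ := List.exists_eq_append_cons_of_exists_not (l := l.reverse)
    (P := P) (by simpa using h)
  refine ⟨l₂.reverse, y, l₁.reverse, ?_, by simpa using h2, h3⟩
  rw [← List.reverse_reverse l, h1]
  simp

namespace IsReducedFreeProduct

variable (hF : IsReducedFreeProduct M N A E)
include hF

/-- The end letters of `m` have indices outside `I`, so nothing cancels against words over `I`: the
concatenation is reduced and nonempty. The coefficient in the middle is absorbed into the next
letter. -/
theorem apply_mul_wordProd_mul_eq_zero_of_ends {I : Set ℕ} {m : List (ℕ × M.toStarSubalgebra)}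
    (hm : IsReducedWord A E m) (hne : m ≠ []) (hhead : ∀ j ∈ (m.map Prod.fst).head?, j ∉ I)
    (hlast : ∀ j ∈ (m.map Prod.fst).getLast?, j ∉ I) {x y : M.toStarSubalgebra}
    (hx : x ∈ wordSpan A E {l | ∀ j ∈ l, j ∈ I}) (hy : y ∈ wordSpan A E {l | ∀ j ∈ l, j ∈ I}) :
    E (x * wordProd m * y) = 0 := by
  induction hx using Submodule.span_induction with
  | zero => simp
  | add x₁ x₂ _ _ h₁ h₂ => rw [add_mul, add_mul, map_add, h₁, h₂, add_zero]
  | smul c x _ h => rw [smul_mul_assoc, smul_mul_assoc, map_smul, h, smul_zero]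
  | mem x hx =>
  induction hy using Submodule.span_induction with
  | zero => simp
  | add y₁ y₂ _ _ h₁ h₂ => rw [mul_add, map_add, h₁, h₂, add_zero]
  | smul c y _ h => rw [mul_smul_comm, map_smul, h, smul_zero]
  | mem y hy =>
  obtain ⟨n₁, hn₁, w₁, hw₁, hI₁, rfl⟩ := hx
  obtain ⟨n₂, hn₂, w₂, hw₂, hI₂, rfl⟩ := hy
  have h1 : IsReducedWord A E (w₁ ++ m) := by
    rw [IsReducedWord.append_iff, List.map_append, List.isChain_append]
    refine ⟨hw₁, hm, hw₁.isChain, hm.isChain, fun x hx y hy hxy => hhead y hy ?_⟩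
    rw [← hxy]
    exact hI₁ x (List.mem_of_getLast? hx)
  cases w₂ with
  | nil =>
    have : n₁ * wordProd w₁ * wordProd m * (n₂ * wordProd []) = n₁ * wordProd (w₁ ++ m) * n₂ := by
      rw [wordProd_append, wordProd_nil, mul_one, mul_assoc n₁]
    rw [this]
    exact hF.apply_mul_mul_eq_zero hn₁ hn₂ (hF.free _ (by simp [hne]) h1)
  | cons p t =>
    obtain ⟨i, b⟩ := p
    have hb := IsReducedWord.cons_iff.1 hw₂
    have h2 : IsReducedWord A E ((w₁ ++ m) ++ (i, n₂ * b) :: t) := by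
      rw [IsReducedWord.append_iff, List.map_append, List.isChain_append]
      have h3 : IsReducedWord A E ([] ++ (i, n₂ * b) :: t) :=
        IsReducedWord.replace (w₁ := []) hw₂ (mul_mem (hF.base_le i hn₂) hb.1)
          (hF.apply_mul_eq_zero hn₂ hb.2.1)
      refine ⟨h1, h3, h1.isChain, h3.isChain, ?_⟩
      intro x hx y hy hxy
      refine hlast x ?_ ?_
      · rw [List.map_append, List.getLast?_append_of_ne_nil _ (by simpa using hne)] at hx
        exact hx
      · rw [hxy]
        have : y = i := by simpa using hy.symm
        rw [this]
        exact hI₂ i (by simp)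
    have : n₁ * wordProd w₁ * wordProd m * (n₂ * wordProd ((i, b) :: t)) =
        n₁ * wordProd ((w₁ ++ m) ++ (i, n₂ * b) :: t) := by
      simp only [wordProd_append, wordProd_cons, mul_assoc]
    rw [this]
    exact hF.apply_mul_eq_zero hn₁ (hF.free _ (by simp) h2)

theorem mem_wordAlgebra_of_mem_base {I : Set ℕ} (hI : I.Nonempty) {n : M.toStarSubalgebra}
    (hn : (n : H →L[ℂ] H) ∈ N) : n ∈ hF.wordAlgebra I :=
  hF.mem_wordAlgebra hI.some_mem (hF.base_le _ hn)

theorem wordSpan_le_wordAlgebra {I : Set ℕ} (hI : I.Nonempty) {x : M.toStarSubalgebra}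
    (hx : x ∈ wordSpan A E {l | ∀ j ∈ l, j ∈ I}) : x ∈ hF.wordAlgebra I := by
  refine (Submodule.span_le (p := (hF.wordAlgebra I).toSubalgebra.toSubmodule)).2 ?_ hx
  rintro _ ⟨n, hn, w, hw, hwI, rfl⟩
  exact mul_mem (S := StarSubalgebra ℂ M.toStarSubalgebra)
    (hF.mem_wordAlgebra_of_mem_base hI hn) (hF.wordProd_mem_wordAlgebra hw hwI)

/-- The compression of a word with a letter outside `I` to the algebra generated by the algebras
with index in `I` vanishes. -/
theorem apply_mul_mul_eq_zero_of_exists_notMem {I : Set ℕ} (hI : I.Nonempty)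
    {r x y : M.toStarSubalgebra} (hr : r ∈ wordSpan A E {l | ∃ j ∈ l, j ∉ I})
    (hx : x ∈ hF.wordAlgebra I) (hy : y ∈ hF.wordAlgebra I) : E (x * r * y) = 0 := by
  induction hr using Submodule.span_induction with
  | zero => simp
  | add r₁ r₂ _ _ h₁ h₂ => rw [mul_add, add_mul, map_add, h₁, h₂, add_zero]
  | smul c r _ h => rw [mul_smul_comm, smul_mul_assoc, map_smul, h, smul_zero]
  | mem r hr =>
  obtain ⟨n, hn, w, hw, ⟨j, hj, hjI⟩, rfl⟩ := hr
  obtain ⟨⟨_, a⟩, hja, rfl⟩ := List.mem_map.1 hj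
  -- The word is cut at its first and last letters outside `I`. The outer pieces have indices in `I`
  -- and join `x` and `y`.
  obtain ⟨r₁, p, r', rfl, hr₁, hp⟩ := List.exists_eq_append_cons_of_exists_not
    (P := fun p : ℕ × M.toStarSubalgebra => p.1 ∈ I) ⟨_, hja, hjI⟩
  obtain ⟨m, q, r₂, hm, hr₂, hq⟩ := List.exists_eq_append_cons_of_exists_not'
    (P := fun p : ℕ × M.toStarSubalgebra => p.1 ∈ I) (l := p :: r') ⟨p, by simp, hp⟩
  have hm' : p :: r' = (m ++ [q]) ++ r₂ := by simp [hm]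
  rw [hm', IsReducedWord.append_iff, IsReducedWord.append_iff] at hw
  have h1 : x * (n * wordProd (r₁ ++ p :: r')) * y =
      (x * n * wordProd r₁) * wordProd (m ++ [q]) * (wordProd r₂ * y) := by
    rw [hm']
    simp only [wordProd_append, mul_assoc]
  rw [h1]
  refine hF.apply_mul_wordProd_mul_eq_zero_of_ends (I := I) hw.2.1.1 (by simp) ?_ ?_
    (hF.wordAlgebra_le_wordSpan (mul_mem (mul_mem hx (hF.mem_wordAlgebra_of_mem_base hI hn))
      (hF.wordProd_mem_wordAlgebra hw.1 ?_)))
    (hF.wordAlgebra_le_wordSpan (mul_mem (hF.wordProd_mem_wordAlgebra hw.2.1.2.1 ?_) hy))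
  · intro j hj
    have h2 : ((m ++ [q]).map Prod.fst).head? = some p.1 := by
      cases m with
      | nil =>
        have : p = q := by simpa using congrArg List.head? hm
        simp [this]
      | cons c m =>
        have : p = c := by simpa using congrArg List.head? hm
        simp [this]
    rw [h2] at hj
    rw [← Option.mem_some_iff.1 hj]
    exact hp
  · intro j hj
    have h2 : ((m ++ [q]).map Prod.fst).getLast? = some q.1 := by simp
    rw [h2] at hj
    rw [← Option.mem_some_iff.1 hj]
    exact hq
  · intro j hj
    obtain ⟨a, ha, rfl⟩ := List.mem_map.1 hj
    exact hr₁ a ha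
  · intro j hj
    obtain ⟨a, ha, rfl⟩ := List.mem_map.1 hj
    exact hr₂ a ha

theorem inner_toGNS_eq_zero_of_mem_closure (h : H) {I : Set ℕ} (hI : I.Nonempty)
    {a r : M.toStarSubalgebra} (ha : a ∈ hF.wordAlgebra I)
    (hr : r ∈ closure (wordSpan A E {l | ∃ j ∈ l, j ∉ I} : Set M.toStarSubalgebra)) :
    ⟪hF.condExp.toGNS h a, hF.condExp.toGNS h r⟫_ℂ = 0 := by
  have hcl : IsClosed {r | ⟪hF.condExp.toGNS h a, hF.condExp.toGNS h r⟫_ℂ = 0} :=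
    isClosed_eq (continuous_const.inner (hF.condExp.continuous_toGNS h)) continuous_const
  refine closure_minimal (fun r hr => ?_) hcl hr
  have := hF.apply_mul_mul_eq_zero_of_exists_notMem hI hr (star_mem ha) (one_mem _)
  rw [mul_one] at this
  change ⟪hF.condExp.toGNS h a, hF.condExp.toGNS h r⟫_ℂ = 0
  rw [IsNormalFaithfulCondExp.inner_toGNS, this]
  simp

/-- Removing the words with a letter outside `I` is contractive. -/
theorem norm_le_norm_add {I : Set ℕ} (hI : I.Nonempty) {q r : M.toStarSubalgebra}
    (hq : q ∈ wordSpan A E {l | ∀ j ∈ l, j ∈ I})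
    (hr : r ∈ wordSpan A E {l | ∃ j ∈ l, j ∉ I}) : ‖q‖ ≤ ‖q + r‖ := by
  have hq' := hF.wordSpan_le_wordAlgebra hI hq
  refine hF.condExp.norm_le_of_norm_toGNS_mul_le (hF.wordAlgebra I) (subset_closure hq')
    (norm_nonneg _) fun h u hu => ?_
  set J := hF.condExp.toGNS h
  -- As `q * u` is orthogonal to `r * u`, Cauchy–Schwarz applied to `‖q u‖² = ⟪q u, (q + r) u⟫`
  -- bounds the action of `q` by `‖q + r‖`.
  have h0 : ⟪J (q * u), J (r * u)⟫_ℂ = 0 := by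
    rw [IsNormalFaithfulCondExp.inner_toGNS, ← mul_assoc,
      hF.apply_mul_mul_eq_zero_of_exists_notMem hI hr (star_mem (mul_mem hq' hu)) hu]
    simp
  have h1 : ⟪J (q * u), J (q * u)⟫_ℂ = ⟪J (q * u), J ((q + r) * u)⟫_ℂ := by
    rw [add_mul, map_add, inner_add_right, h0, add_zero]
  have h2 : ‖J (q * u)‖ * ‖J (q * u)‖ ≤ ‖J (q * u)‖ * (‖q + r‖ * ‖J u‖) := by
    calc ‖J (q * u)‖ * ‖J (q * u)‖ = ‖⟪J (q * u), J (q * u)⟫_ℂ‖ := by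
          rw [inner_self_eq_norm_sq_to_K, ← sq]; simp
      _ ≤ ‖J (q * u)‖ * ‖J ((q + r) * u)‖ := by rw [h1]; exact norm_inner_le_norm _ _
      _ ≤ _ := by gcongr; exact hF.condExp.norm_toGNS_mul_le h _ _
  rcases (norm_nonneg (J (q * u))).eq_or_lt with h3 | h3
  · rw [← h3]; positivity
  · exact le_of_mul_le_mul_left h2 h3

/-- Contractivity of the truncation on polynomials, applied to differences, makes the truncations of
a convergent sequence of polynomials Cauchy in norm. -/
theorem exists_truncation {I : Set ℕ} (hI : I.Nonempty) {S : Set (List ℕ)} {y : M.toStarSubalgebra}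
    (hy : y ∈ closure (wordSpan A E S : Set M.toStarSubalgebra)) :
    ∃ z ∈ closure (wordSpan A E {l | l ∈ S ∧ ∀ j ∈ l, j ∈ I} : Set M.toStarSubalgebra),
      y - z ∈ closure (wordSpan A E {l | l ∈ S ∧ ∃ j ∈ l, j ∉ I} : Set M.toStarSubalgebra) := by
  have hcomplete : CompleteSpace M.toStarSubalgebra := M.isClosed.completeSpace_coe
  obtain ⟨p, hp, hlim⟩ := mem_closure_iff_seq_limit.1 hy
  have hdec : ∀ i, ∃ q ∈ wordSpan A E {l | l ∈ S ∧ ∀ j ∈ l, j ∈ I},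
      ∃ r ∈ wordSpan A E {l | l ∈ S ∧ ∃ j ∈ l, j ∉ I}, q + r = p i := by
    intro i
    refine Submodule.mem_sup.1 (wordSpan_union _ _ (wordSpan_mono (fun l hl => ?_) (hp i)))
    by_cases h : ∀ j ∈ l, j ∈ I
    · exact Or.inl ⟨hl, h⟩
    · push Not at h
      exact Or.inr ⟨hl, h⟩
  choose q hq r hr hqr using hdec
  have hcauchy : CauchySeq q := by
    rw [Metric.cauchySeq_iff]
    intro ε hε
    obtain ⟨n, hn⟩ := Metric.cauchySeq_iff.1 hlim.cauchySeq ε hε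
    refine ⟨n, fun i hi j hj => lt_of_le_of_lt ?_ (hn i hi j hj)⟩
    rw [dist_eq_norm, dist_eq_norm, ← hqr, ← hqr, add_sub_add_comm]
    exact hF.norm_le_norm_add hI
      (wordSpan_mono (fun l hl => hl.2) (sub_mem (hq i) (hq j)))
      (wordSpan_mono (fun l hl => hl.2) (sub_mem (hr i) (hr j)))
  obtain ⟨z, hz⟩ := cauchySeq_tendsto_of_complete hcauchy
  refine ⟨z, mem_closure_of_tendsto hz (Eventually.of_forall hq),
    mem_closure_of_tendsto (hlim.sub hz) (Eventually.of_forall fun i => ?_)⟩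
  have : p i - q i = r i := by rw [← hqr]; abel
  rw [this]
  exact hr i

theorem eq_zero_of_orthogonal {S : StarSubalgebra ℂ M.toStarSubalgebra} {w : M.toStarSubalgebra}
    (hw : ∀ h, hF.condExp.toGNS h w ∈ closure (hF.condExp.toGNS h '' S))
    (horth : ∀ h, ∀ a ∈ S, ⟪hF.condExp.toGNS h a, hF.condExp.toGNS h w⟫_ℂ = 0) : w = 0 := by
  refine hF.condExp.eq_zero_of_norm_toGNS fun h => ?_
  have hcl : IsClosed {v | ⟪v, hF.condExp.toGNS h w⟫_ℂ = 0} :=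
    isClosed_eq (continuous_id.inner continuous_const) continuous_const
  have h1 : ⟪hF.condExp.toGNS h w, hF.condExp.toGNS h w⟫_ℂ = 0 := by
    refine closure_minimal ?_ hcl (hw h)
    rintro _ ⟨a, ha, rfl⟩
    exact horth h a ha
  rw [inner_self_eq_norm_sq_to_K] at h1
  simpa using h1

end IsReducedFreeProduct

theorem subset_vnGenerated (S : Set (H →L[ℂ] H)) : S ⊆ vnGenerated S := by
  intro s hs
  change s ∈ StarSubalgebra.centralizer ℂ _
  rw [StarSubalgebra.mem_centralizer_iff]
  intro t ht
  have h1 := (StarSubalgebra.mem_centralizer_iff ℂ).1 ht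
  exact ⟨((h1 s hs).1).symm, by
    have := congrArg star (h1 s hs).2
    simpa using this⟩

theorem mem_centralizer_of_mem_vnGenerated {S T : Set (H →L[ℂ] H)} (hST : ∀ s ∈ S, s ∈ T ∧ star s ∈ T)
    {a : H →L[ℂ] H} (ha : a ∈ vnGenerated S) : a ∈ Set.centralizer (Set.centralizer T) := by
  change a ∈ StarSubalgebra.centralizer ℂ _ at ha
  rw [StarSubalgebra.mem_centralizer_iff] at ha
  intro t ht
  refine (ha t ?_).1
  change t ∈ StarSubalgebra.centralizer ℂ S
  rw [StarSubalgebra.mem_centralizer_iff]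
  exact fun s hs => ⟨ht s (hST s hs).1, ht _ (hST s hs).2⟩

namespace IsReducedFreeProduct

variable (hF : IsReducedFreeProduct M N A E)
include hF

theorem mem_bicommutant_of_mem_freeFiltration {n : ℕ} {a : H →L[ℂ] H} (ha : a ∈ freeFiltration A n) :
    a ∈ Set.centralizer (Set.centralizer (((hF.wordAlgebra (Set.Iio (n + 1))).map
      M.toStarSubalgebra.subtype : StarSubalgebra ℂ (H →L[ℂ] H)) : Set (H →L[ℂ] H))) := by
  refine mem_centralizer_of_mem_vnGenerated (fun s hs => ?_) ha
  simp only [Set.mem_iUnion, Finset.mem_range] at hs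
  obtain ⟨i, hi, hs⟩ := hs
  exact ⟨⟨⟨s, hF.le i hs⟩, hF.mem_wordAlgebra (Set.mem_Iio.2 hi) hs, rfl⟩,
    ⟨⟨star s, hF.le i (star_mem hs)⟩, hF.mem_wordAlgebra (Set.mem_Iio.2 hi) (star_mem hs), rfl⟩⟩

theorem mem_freeFiltration_of_mem_wordAlgebra {n : ℕ} {a : M.toStarSubalgebra}
    (ha : a ∈ hF.wordAlgebra (Set.Iio (n + 1))) : (a : H →L[ℂ] H) ∈ freeFiltration A n := by
  refine StarAlgebra.adjoin_le
    (S := (freeFiltration A n).toStarSubalgebra.comap M.toStarSubalgebra.subtype) ?_ ha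
  rintro b ⟨i, hi, hb⟩
  refine subset_vnGenerated _ ?_
  simp only [Set.mem_iUnion, Finset.mem_range]
  exact ⟨i, hi, hb⟩

omit hF in
theorem freeFiltration_mono {m n : ℕ} (hmn : m ≤ n) : freeFiltration A m ≤ freeFiltration A n := by
  intro a ha
  have h1 := mem_centralizer_of_mem_vnGenerated (T := (freeFiltration A n : Set (H →L[ℂ] H)))
    (fun s hs => ?_) ha
  · rw [(freeFiltration A n).centralizer_centralizer] at h1
    exact h1
  · simp only [Set.mem_iUnion, Finset.mem_range] at hs
    obtain ⟨i, hi, hs⟩ := hs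
    have : s ∈ freeFiltration A n := by
      refine subset_vnGenerated _ ?_
      simp only [Set.mem_iUnion, Finset.mem_range]
      exact ⟨i, by omega, hs⟩
    exact ⟨this, star_mem this⟩

/-- An element of `𝒜 n` which is a limit of polynomials is a limit of polynomials in the letters
of index at most `n`. -/
theorem mem_closure_wordSpan_of_mem_freeFiltration {n : ℕ} {S : Set (List ℕ)}
    {y : M.toStarSubalgebra} (hy : y ∈ closure (wordSpan A E S : Set M.toStarSubalgebra))
    (hyn : (y : H →L[ℂ] H) ∈ freeFiltration A n) :
    y ∈ closure (wordSpan A E {l | l ∈ S ∧ ∀ j ∈ l, j < n + 1} : Set M.toStarSubalgebra) := by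
  have hI : (Set.Iio (n + 1)).Nonempty := ⟨0, by simp⟩
  obtain ⟨z, hz, hyz⟩ := hF.exists_truncation hI hy
  suffices h : y - z = 0 by
    rw [sub_eq_zero.1 h]
    exact hz
  -- The remainder `y - z` is orthogonal to the word algebra. It is also a GNS limit of that
  -- algebra: `y` by the density theorem, `z` as a norm limit of polynomials.
  refine hF.eq_zero_of_orthogonal (S := hF.wordAlgebra (Set.Iio (n + 1))) (fun h => ?_)
    fun h a ha => hF.inner_toGNS_eq_zero_of_mem_closure h hI ha
      (closure_mono (wordSpan_mono fun l hl => hl.2) hyz)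
  have h1 := hF.condExp.toGNS_mem_closure h (hF.wordAlgebra (Set.Iio (n + 1)))
    (fun a ha => hF.mem_bicommutant_of_mem_freeFiltration ha) hyn
  have h2 := hF.condExp.toGNS_mem_closure_of_mem_closure h (closure_mono
    (t := (hF.wordAlgebra (Set.Iio (n + 1)) : Set M.toStarSubalgebra))
    (fun x hx => hF.wordSpan_le_wordAlgebra hI (wordSpan_mono (fun l hl => hl.2) hx)) hz)
  rw [map_sub]
  exact ((hF.wordAlgebra (Set.Iio (n + 1))).toSubalgebra.toSubmodule.map
    (hF.condExp.toGNS h).toLinearMap).topologicalClosure.sub_mem h1 h2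

/-- A limit of polynomials whose conditional expectation onto `𝒜 n` vanishes is a limit of
polynomials all of whose words have a letter of index greater than `n`. -/
theorem mem_closure_wordSpan_of_condExp_eq_zero {n : ℕ} {S : Set (List ℕ)}
    {y : M.toStarSubalgebra} (hy : y ∈ closure (wordSpan A E S : Set M.toStarSubalgebra))
    (hyn : ∀ a : M.toStarSubalgebra, (a : H →L[ℂ] H) ∈ freeFiltration A n → E (a * y) = 0) :
    y ∈ closure (wordSpan A E {l | l ∈ S ∧ ∃ j ∈ l, ¬ j < n + 1} : Set M.toStarSubalgebra) := by
  have hI : (Set.Iio (n + 1)).Nonempty := ⟨0, by simp⟩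
  obtain ⟨z, hz, hyz⟩ := hF.exists_truncation hI hy
  suffices h : z = 0 by
    rw [h, sub_zero] at hyz
    exact hyz
  -- Here the truncation `z` itself vanishes: it is a limit of the word algebra, and it is
  -- orthogonal to it because both `y` and `y - z` are.
  refine hF.eq_zero_of_orthogonal (S := hF.wordAlgebra (Set.Iio (n + 1))) (fun h => ?_)
    fun h a ha => ?_
  · exact hF.condExp.toGNS_mem_closure_of_mem_closure h (closure_mono
      (t := (hF.wordAlgebra (Set.Iio (n + 1)) : Set M.toStarSubalgebra))
      (fun x hx => hF.wordSpan_le_wordAlgebra hI (wordSpan_mono (fun l hl => hl.2) hx)) hz)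
  · have h1 := hF.inner_toGNS_eq_zero_of_mem_closure h hI ha
      (closure_mono (wordSpan_mono fun l hl => hl.2) hyz)
    have h2 : ⟪hF.condExp.toGNS h a, hF.condExp.toGNS h y⟫_ℂ = 0 := by
      rw [IsNormalFaithfulCondExp.inner_toGNS,
        hyn _ (hF.mem_freeFiltration_of_mem_wordAlgebra (star_mem ha))]
      simp
    rw [map_sub, inner_sub_right, h2, zero_sub, neg_eq_zero] at h1
    exact h1

omit hF in
theorem freePoly_le (d : ℕ) {x : M.toStarSubalgebra} (hx : x ∈ freePoly A E d) :
    x ∈ closure (wordSpan A E {l | l.length ≤ d} : Set M.toStarSubalgebra) := by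
  refine closure_mono (show ((⨆ m ∈ Finset.range (d + 1), homogeneousPoly A E m :
    Submodule ℂ M.toStarSubalgebra) : Set M.toStarSubalgebra) ⊆ _ from ?_) hx
  refine SetLike.coe_subset_coe.2 (iSup₂_le fun m hm => ?_)
  rw [Finset.mem_range] at hm
  cases m with
  | zero =>
    refine Submodule.span_le.2 fun a ha => ?_
    have := mul_wordProd_mem_wordSpan (A := A) (E := E) (S := {l | l.length ≤ d}) ha .nil (by simp)
    rwa [wordProd_nil, mul_one] at this
  | succ m =>
    refine Submodule.span_le.2 ?_
    rintro _ ⟨w, hw, hlen, rfl⟩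
    refine wordProd_mem_wordSpan hw ?_
    simp only [Set.mem_ofPred_eq, List.length_map]
    omega

/-- Adaptedness excludes indices above `k + 1`, and the martingale property excludes words with all
indices at most `k`, so `k + 1` occurs in each word. The difference of index `0` is left out since
it may have a component in `N`. -/
theorem martingaleDiff_succ_mem {d : ℕ} {x : ℕ → M.toStarSubalgebra} (hx : IsFreeMartingale A E x)
    (hd : ∀ k, martingaleDiff x k ∈ freePoly A E d) (k : ℕ) :
    martingaleDiff x (k + 1) ∈
      closure (wordSpan A E {l | l.length ≤ d ∧ k + 1 ∈ l} : Set M.toStarSubalgebra) := by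
  have h1 := hF.mem_closure_wordSpan_of_mem_freeFiltration (n := k + 1) (freePoly_le d (hd (k + 1)))
    (show (x (k + 1) : H →L[ℂ] H) - (x k : H →L[ℂ] H) ∈ freeFiltration A (k + 1) from
      sub_mem (hx.adapted _) (freeFiltration_mono k.le_succ (hx.adapted k)))
  have h2 := hF.mem_closure_wordSpan_of_condExp_eq_zero (n := k) h1 (fun a ha => by
    rw [martingaleDiff, mul_sub, map_sub, (hx.condExp k).2 a ha, sub_self])
  refine closure_mono (wordSpan_mono ?_) h2
  rintro l ⟨⟨hl, hlt⟩, j, hj, hnj⟩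
  have : j = k + 1 := by have := hlt j hj; omega
  exact ⟨hl, this ▸ hj⟩

end IsReducedFreeProduct

end Truncation

/-! ### The square function estimate. -/

section SquareFunction

open Filter Topology
open scoped InnerProductSpace

variable {H : Type u} [NormedAddCommGroup H] [InnerProductSpace ℂ H] [CompleteSpace H]
variable {M N : VonNeumannAlgebra H} {A : ℕ → VonNeumannAlgebra H}
  {E : M.toStarSubalgebra →ₗ[ℂ] N.toStarSubalgebra}

namespace IsReducedFreeProduct

variable (hF : IsReducedFreeProduct M N A E)
include hF

/-- If a word `a` of length at most `s` contains the index `k`, and `k` is not among the first `s`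
indices of the word `u`, then in `a * u` the index `k` is always among the first `s` indices. -/
theorem wordProd_mul_wordProd_mem_wordSpan_take (k : ℕ) (a : List (ℕ × M.toStarSubalgebra)) :
    ∀ (s : ℕ) (u : List (ℕ × M.toStarSubalgebra)) (n : M.toStarSubalgebra),
      IsReducedWord A E a → IsReducedWord A E u → (n : H →L[ℂ] H) ∈ N → a.length ≤ s →
      k ∈ a.map Prod.fst → k ∉ (u.map Prod.fst).take s →
      wordProd a * (n * wordProd u) ∈ wordSpan A E {l | k ∈ l.take s} := by
  induction a using List.reverseRecOn with
  | nil => intro s u n _ _ _ _ hk; simp at hk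
  | append_singleton a p ih =>
    obtain ⟨i, b⟩ := p
    intro s u n ha hu hn hlen hk hku
    have hap := IsReducedWord.append_iff.1 ha
    have hb := IsReducedWord.cons_iff.1 hap.2.1
    have hlen' : (a ++ [(i, b)]).length = a.length + 1 := by simp
    have hprefix : ∀ t : List ℕ, k ∈ ((a.map Prod.fst ++ i :: t)).take s := by
      intro t
      have h1 : a.map Prod.fst ++ i :: t = (a ++ [(i, b)]).map Prod.fst ++ t := by simp
      rw [h1, List.take_append, List.take_of_length_le (by simpa using hlen)]
      exact List.mem_append_left _ hk
    cases u with
    | nil =>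
      rw [wordProd_nil, mul_one]
      refine hF.wordProd_mul_mem_wordSpan ha ?_ hn
      simpa using hprefix []
    | cons q t =>
      obtain ⟨j, e⟩ := q
      have he := IsReducedWord.cons_iff.1 hu
      by_cases hij : i = j
      · subst hij
        set c : M.toStarSubalgebra := b * n * e with hc
        have hcA : (c : H →L[ℂ] H) ∈ A i := mul_mem (mul_mem hb.1 (hF.base_le i hn)) he.1
        have h1 : wordProd (a ++ [(i, b)]) * (n * wordProd ((i, e) :: t)) =
            wordProd (a ++ (i, c - hF.mean c) :: t) + wordProd a * (hF.mean c * wordProd t) := by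
          simp only [wordProd_append, wordProd_cons, wordProd_nil, mul_one, sub_mul, mul_sub]
          rw [hc]
          simp only [mul_assoc, sub_add_cancel]
        have h2 : IsReducedWord A E (a ++ (i, c - hF.mean c) :: t) := by
          rw [IsReducedWord.append_iff, IsReducedWord.cons_iff]
          refine ⟨hap.1, ⟨hF.sub_mean_mem hcA, hF.apply_sub_mean c, he.2.2.1,
            by simpa using he.2.2.2⟩, ?_⟩
          have h3 := ha.isChain
          have h4 := hu.isChain
          simp only [List.map_append, List.map_cons, List.map_nil] at h3 h4 ⊢
          rw [List.isChain_append] at h3 ⊢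
          refine ⟨h3.1, h4, ?_⟩
          simpa using h3.2.2
        rw [h1]
        refine add_mem (wordProd_mem_wordSpan h2 (by simpa using hprefix (t.map Prod.fst))) ?_
        -- In the mean term both words lose the letter of index `i`, so the window shrinks by one.
        -- As `i` is the first index of `u`, it differs from `k`, and `k` survives in the shortened
        -- left word.
        obtain ⟨s, rfl⟩ : ∃ s', s = s' + 1 := ⟨s - 1, by omega⟩
        rw [List.map_cons, List.take_succ_cons, List.mem_cons, not_or] at hku
        have hka : k ∈ a.map Prod.fst := by
          rw [List.map_append, List.mem_append] at hk
          rcases hk with hk | hk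
          · exact hk
          · exact absurd (by simpa using hk) hku.1
        refine wordSpan_mono (fun l hl => ?_)
          (ih s t (hF.mean c) hap.1 he.2.2.1 (hF.mean_mem c) (by omega) hka hku.2)
        exact List.take_subset_take_left l (Nat.le_succ s) hl
      · have h1 : wordProd (a ++ [(i, b)]) * (n * wordProd ((j, e) :: t)) =
            wordProd (a ++ (i, b * n) :: (j, e) :: t) := by
          simp only [wordProd_append, wordProd_cons, wordProd_nil, mul_one, mul_assoc]
        rw [h1]
        refine wordProd_mem_wordSpan ?_ (by simpa using hprefix ((j :: t.map Prod.fst)))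
        have h3 := ha.isChain
        have h4 := hu.isChain
        simp only [List.map_append, List.map_cons, List.map_nil] at h3 h4
        have h5 : (i :: j :: t.map Prod.fst).IsChain (· ≠ ·) := List.IsChain.cons_cons hij h4
        rw [IsReducedWord.append_iff, IsReducedWord.cons_iff]
        refine ⟨hap.1, ⟨mul_mem hb.1 (hF.base_le i hn), hF.apply_mul_eq_zero' hn hb.2.1, hu,
          by simpa using h5⟩, ?_⟩
        simp only [List.map_append, List.map_cons]
        rw [List.isChain_append] at h3 ⊢
        refine ⟨h3.1, h5, ?_⟩
        simpa using h3.2.2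

theorem mul_mem_wordSpan_take {d k : ℕ} {y u : M.toStarSubalgebra}
    (hy : y ∈ wordSpan A E {l | l.length ≤ d ∧ k ∈ l})
    (hu : u ∈ wordSpan A E {l | k ∉ l.take d}) : y * u ∈ wordSpan A E {l | k ∈ l.take d} := by
  induction hy using Submodule.span_induction with
  | zero => rw [zero_mul]; exact zero_mem _
  | add x y _ _ hx hy => rw [add_mul]; exact add_mem hx hy
  | smul c x _ hx => rw [smul_mul_assoc]; exact Submodule.smul_mem _ _ hx
  | mem y hy =>
  induction hu using Submodule.span_induction with
  | zero => rw [mul_zero]; exact zero_mem _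
  | add x y _ _ hx hy => rw [mul_add]; exact add_mem hx hy
  | smul c x _ hx => rw [mul_smul_comm]; exact Submodule.smul_mem _ _ hx
  | mem u hu =>
  obtain ⟨n, hn, a, ha, ⟨hlen, hk⟩, rfl⟩ := hy
  obtain ⟨n', hn', w, hw, hkw, rfl⟩ := hu
  rw [mul_assoc]
  exact mul_mem_wordSpan hn (hF.wordProd_mul_wordProd_mem_wordSpan_take k a d w n' ha hw hn'
    (by simpa using hlen) hk hkw)

/-- In terms of the projection `P k` onto words with `k` among the first `d` indices, this is `(1 -
P k) y (1 - P k) = 0`, extended to norm limits by continuity. -/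
theorem inner_toGNS_mul_eq_zero (h : H) {d k : ℕ} {y u z : M.toStarSubalgebra}
    (hy : y ∈ closure (wordSpan A E {l | l.length ≤ d ∧ k ∈ l} : Set M.toStarSubalgebra))
    (hu : u ∈ wordSpan A E {l | k ∉ l.take d}) (hz : z ∈ wordSpan A E {l | k ∉ l.take d}) :
    ⟪hF.condExp.toGNS h z, hF.condExp.toGNS h (y * u)⟫_ℂ = 0 := by
  have hcl : IsClosed {y | ⟪hF.condExp.toGNS h z, hF.condExp.toGNS h (y * u)⟫_ℂ = 0} :=
    isClosed_eq (continuous_const.inner ((hF.condExp.continuous_toGNS h).comp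
      (continuous_id.mul continuous_const))) continuous_const
  refine closure_minimal (fun y hy => ?_) hcl hy
  exact hF.inner_toGNS_eq_zero_of_wordSpan h
    (S := {l | k ∉ l.take d}) (T := {l | k ∈ l.take d})
    (Set.disjoint_left.2 fun l hl hl' => hl hl') hz (hF.mul_mem_wordSpan_take hy hu)

theorem norm_toGNS_sum_sq (h : H) (T : Finset (List ℕ)) {f : List ℕ → M.toStarSubalgebra}
    (hf : ∀ l, f l ∈ wordSpan A E {l}) :
    ‖hF.condExp.toGNS h (∑ l ∈ T, f l)‖ ^ 2 = ∑ l ∈ T, ‖hF.condExp.toGNS h (f l)‖ ^ 2 := by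
  classical
  induction T using Finset.induction_on with
  | empty => simp
  | insert l T hl ih =>
    rw [Finset.sum_insert hl, Finset.sum_insert hl, map_add, ← ih, sq, sq, sq]
    refine norm_add_sq_eq_norm_sq_add_norm_sq_of_inner_eq_zero (𝕜 := ℂ) _ _ ?_
    refine hF.inner_toGNS_eq_zero_of_wordSpan h (S := {l}) (T := {l' | l' ∈ T})
      (Set.disjoint_left.2 ?_) (hf l) (sum_mem fun l' hl' => ?_)
    · rintro _ rfl h; exact hl h
    · exact wordSpan_mono (by simpa using hl') (hf l')

/-- The components of `u` along the words with the index `k` among the first `d` ones. Each word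
contributes to at most `d` of them. -/
theorem exists_components (d : ℕ) {u : M.toStarSubalgebra} (hu : u ∈ hF.wordAlgebra Set.univ) :
    ∃ v : ℕ → M.toStarSubalgebra, (∀ k, v k ∈ wordSpan A E {l | k ∈ l.take d}) ∧
      (∀ k, u - v k ∈ wordSpan A E {l | k ∉ l.take d}) ∧
      ∀ (h : H) (s : Finset ℕ),
        ∑ k ∈ s, ‖hF.condExp.toGNS h (v k)‖ ^ 2 ≤ d * ‖hF.condExp.toGNS h u‖ ^ 2 := by
  classical
  have hu' : u ∈ ⨆ l, wordSpan A E {l} := wordSpan_univ_le_iSup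
    (wordSpan_mono (Set.subset_univ _) (hF.wordAlgebra_le_wordSpan hu))
  obtain ⟨f, hf, hsum⟩ := (Submodule.mem_iSup_iff_exists_finsupp _ _).1 hu'
  replace hsum : ∑ l ∈ f.support, f l = u := hsum
  refine ⟨fun k => ∑ l ∈ f.support with k ∈ l.take d, f l, fun k => sum_mem fun l hl => ?_,
    fun k => ?_, fun h s => ?_⟩
  · exact wordSpan_mono (by simpa using (Finset.mem_filter.1 hl).2) (hf l)
  · have h1 := Finset.sum_filter_add_sum_filter_not f.support (fun l => k ∈ l.take d) f
    have h2 : u - ∑ l ∈ f.support with k ∈ l.take d, f l =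
        ∑ l ∈ f.support with ¬ k ∈ l.take d, f l := by
      rw [← hsum, ← h1, add_sub_cancel_left]
    rw [h2]
    exact sum_mem fun l hl => wordSpan_mono (by simpa using (Finset.mem_filter.1 hl).2) (hf l)
  · simp only [hF.norm_toGNS_sum_sq h _ hf]
    simp only [Finset.sum_filter]
    rw [Finset.sum_comm, ← hsum, hF.norm_toGNS_sum_sq h _ hf, Finset.mul_sum]
    refine Finset.sum_le_sum fun l _ => ?_
    rw [← Finset.sum_filter, Finset.sum_const, nsmul_eq_mul]
    gcongr
    calc (s.filter fun k => k ∈ l.take d).card ≤ (l.take d).toFinset.card :=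
          Finset.card_le_card fun k hk => List.mem_toFinset.2 (Finset.mem_filter.1 hk).2
      _ ≤ (l.take d).length := List.toFinset_card_le _
      _ ≤ d := List.length_take_le _ _

omit hF in
theorem sum_mul_le_of_sum_sq_le {ι : Type*} (s : Finset ι) {a b : ι → ℝ} {α β : ℝ} (hα : 0 ≤ α)
    (hβ : 0 ≤ β) (ha : ∑ i ∈ s, a i ^ 2 ≤ α ^ 2) (hb : ∑ i ∈ s, b i ^ 2 ≤ β ^ 2) :
    ∑ i ∈ s, a i * b i ≤ α * β := by
  refine (Real.sum_mul_le_sqrt_mul_sqrt s a b).trans ?_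
  gcongr
  · exact Real.sqrt_le_iff.2 ⟨hα, ha⟩
  · exact Real.sqrt_le_iff.2 ⟨hβ, hb⟩

theorem norm_inner_sum_mul_le (h : H) {d : ℕ} (s : Finset ℕ) {y : ℕ → M.toStarSubalgebra}
    (hy : ∀ k ∈ s, y k ∈
      closure (wordSpan A E {l | l.length ≤ d ∧ k ∈ l} : Set M.toStarSubalgebra))
    {R : ℝ} (hR : 0 ≤ R)
    (hcol : ‖∑ k ∈ s, star (y k : H →L[ℂ] H) * (y k : H →L[ℂ] H)‖ ≤ R ^ 2)
    (hrow : ‖∑ k ∈ s, (y k : H →L[ℂ] H) * star (y k : H →L[ℂ] H)‖ ≤ R ^ 2)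
    {u z : M.toStarSubalgebra} (hu : u ∈ hF.wordAlgebra Set.univ)
    (hz : z ∈ hF.wordAlgebra Set.univ) :
    ‖⟪hF.condExp.toGNS h z, hF.condExp.toGNS h ((∑ k ∈ s, y k) * u)⟫_ℂ‖ ≤
      ((2 * √d + d) * R) * (‖hF.condExp.toGNS h z‖ * ‖hF.condExp.toGNS h u‖) := by
  obtain ⟨v, hv, huv, hvd⟩ := hF.exists_components d hu
  obtain ⟨w, hw, hzw, hwd⟩ := hF.exists_components d hz
  set J := hF.condExp.toGNS h
  have hd : (√d) ^ 2 = (d : ℝ) := Real.sq_sqrt (Nat.cast_nonneg d)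
  -- Weak form of `y = P y + y P - P y P`, with `v k = P k u` and `w k = P k z`. In the second term
  -- `y k` is moved to the left so that the row square function controls it.
  have hsplit : ∀ k ∈ s, ⟪J z, J (y k * u)⟫_ℂ = ⟪J (w k), J (y k * u)⟫_ℂ +
      ⟪J (star (y k) * z), J (v k)⟫_ℂ - ⟪J (w k), J (y k * v k)⟫_ℂ := by
    intro k hk
    have h0 := hF.inner_toGNS_mul_eq_zero h (hy k hk) (huv k) (hzw k)
    change ⟪J (z - w k), J (y k * (u - v k))⟫_ℂ = 0 at h0
    have h1 : ⟪J (star (y k) * z), J (v k)⟫_ℂ = ⟪J z, J (y k * v k)⟫_ℂ := by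
      rw [hF.condExp.inner_toGNS_mul, star_star]
    rw [mul_sub, map_sub, map_sub, inner_sub_left, inner_sub_right, inner_sub_right] at h0
    rw [h1]
    linear_combination h0
  have hVs : ∑ k ∈ s, ‖J (v k)‖ ^ 2 ≤ (√d * ‖J u‖) ^ 2 := by
    rw [mul_pow, hd]; exact hvd h s
  have hWs : ∑ k ∈ s, ‖J (w k)‖ ^ 2 ≤ (√d * ‖J z‖) ^ 2 := by
    rw [mul_pow, hd]; exact hwd h s
  have hYs : ∑ k ∈ s, ‖J (y k * u)‖ ^ 2 ≤ (R * ‖J u‖) ^ 2 := by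
    refine (hF.condExp.sum_norm_toGNS_mul_sq_le h s y u).trans ?_
    rw [mul_pow]
    gcongr
  have hZs : ∑ k ∈ s, ‖J (star (y k) * z)‖ ^ 2 ≤ (R * ‖J z‖) ^ 2 := by
    refine (hF.condExp.sum_norm_toGNS_mul_sq_le h s (fun k => star (y k)) z).trans ?_
    rw [mul_pow]
    gcongr
    simpa using hrow
  have hnorm : ∀ k ∈ s, ‖(y k : H →L[ℂ] H)‖ ≤ R := by
    intro k hk
    have h1 : star (y k : H →L[ℂ] H) * (y k : H →L[ℂ] H) ≤
        ∑ k ∈ s, star (y k : H →L[ℂ] H) * (y k : H →L[ℂ] H) :=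
      Finset.single_le_sum (f := fun k => star (y k : H →L[ℂ] H) * (y k : H →L[ℂ] H))
        (fun i _ => star_mul_self_nonneg _) hk
    have h2 := (CStarAlgebra.norm_le_norm_of_nonneg_of_le (star_mul_self_nonneg _) h1).trans hcol
    rw [CStarRing.norm_star_mul_self, ← sq] at h2
    exact le_of_sq_le_sq h2 hR
  rw [Finset.sum_mul, map_sum, inner_sum]
  calc ‖∑ k ∈ s, ⟪J z, J (y k * u)⟫_ℂ‖
      ≤ ∑ k ∈ s, (‖J (w k)‖ * ‖J (y k * u)‖ + ‖J (star (y k) * z)‖ * ‖J (v k)‖ +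
          R * (‖J (w k)‖ * ‖J (v k)‖)) := by
        refine norm_sum_le_of_le _ fun k hk => ?_
        rw [hsplit k hk]
        refine (norm_sub_le _ _).trans (add_le_add ((norm_add_le _ _).trans
          (add_le_add (norm_inner_le_norm _ _) (norm_inner_le_norm _ _))) ?_)
        refine (norm_inner_le_norm _ _).trans ?_
        have h1 := hF.condExp.norm_toGNS_mul_le h (y k) (v k)
        have h2 : ‖J (y k * v k)‖ ≤ R * ‖J (v k)‖ :=
          h1.trans (mul_le_mul_of_nonneg_right (hnorm k hk) (norm_nonneg _))
        calc _ ≤ ‖J (w k)‖ * (R * ‖J (v k)‖) := by gcongr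
          _ = _ := by ring
    _ ≤ (√d * ‖J z‖) * (R * ‖J u‖) + (R * ‖J z‖) * (√d * ‖J u‖) +
          R * ((√d * ‖J z‖) * (√d * ‖J u‖)) := by
        rw [Finset.sum_add_distrib, Finset.sum_add_distrib, ← Finset.mul_sum]
        gcongr
        · exact sum_mul_le_of_sum_sq_le s (by positivity) (by positivity) hWs hYs
        · exact sum_mul_le_of_sum_sq_le s (by positivity) (by positivity) hZs hVs
        · exact sum_mul_le_of_sum_sq_le s (by positivity) (by positivity) hWs hVs
    _ = _ := by linear_combination (R * ‖J z‖ * ‖J u‖) * hd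

/-- The bilinear estimate is tested at `z = x * u`. This is only a norm limit of elements of the
word algebra, so the estimate is first extended in `z` by continuity. -/
theorem norm_sum_le {d : ℕ} (s : Finset ℕ) {y : ℕ → M.toStarSubalgebra}
    (hy : ∀ k ∈ s, y k ∈
      closure (wordSpan A E {l | l.length ≤ d ∧ k ∈ l} : Set M.toStarSubalgebra))
    {R : ℝ} (hR : 0 ≤ R)
    (hcol : ‖∑ k ∈ s, star (y k : H →L[ℂ] H) * (y k : H →L[ℂ] H)‖ ≤ R ^ 2)
    (hrow : ‖∑ k ∈ s, (y k : H →L[ℂ] H) * star (y k : H →L[ℂ] H)‖ ≤ R ^ 2) :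
    ‖∑ k ∈ s, (y k : H →L[ℂ] H)‖ ≤ (2 * √d + d) * R := by
  set x : M.toStarSubalgebra := ∑ k ∈ s, y k with hx
  have hxc : (x : H →L[ℂ] H) = ∑ k ∈ s, (y k : H →L[ℂ] H) := by simp [hx]
  rw [← hxc]
  have hxW : x ∈ closure (hF.wordAlgebra Set.univ : Set M.toStarSubalgebra) := by
    refine sum_mem (B := StarSubalgebra ℂ M.toStarSubalgebra)
      (S := (hF.wordAlgebra Set.univ).topologicalClosure) fun k hk => ?_
    exact closure_mono (fun a ha => hF.wordSpan_le_wordAlgebra Set.univ_nonempty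
      (wordSpan_mono (by intro l _; simp) ha)) (hy k hk)
  refine hF.condExp.norm_le_of_norm_toGNS_mul_le (hF.wordAlgebra Set.univ) hxW (by positivity)
    fun h u hu => ?_
  set J := hF.condExp.toGNS h
  have hcl : IsClosed {z | ‖⟪J z, J (x * u)⟫_ℂ‖ ≤ ((2 * √d + d) * R) * (‖J z‖ * ‖J u‖)} :=
    isClosed_le ((hF.condExp.continuous_toGNS h).inner continuous_const).norm
      (continuous_const.mul ((hF.condExp.continuous_toGNS h).norm.mul continuous_const))
  have hxu : x * u ∈ closure (hF.wordAlgebra Set.univ : Set M.toStarSubalgebra) :=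
    mul_mem (S := StarSubalgebra ℂ M.toStarSubalgebra)
      (s := (hF.wordAlgebra Set.univ).topologicalClosure) hxW (subset_closure hu)
  have h1 : ‖⟪J (x * u), J (x * u)⟫_ℂ‖ ≤ ((2 * √d + d) * R) * (‖J (x * u)‖ * ‖J u‖) :=
    closure_minimal (fun z hz => hF.norm_inner_sum_mul_le h s hy hR hcol hrow hu hz) hcl hxu
  have h2 : ‖⟪J (x * u), J (x * u)⟫_ℂ‖ = ‖J (x * u)‖ * ‖J (x * u)‖ := by
    rw [inner_self_eq_norm_sq_to_K, ← sq]; simp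
  rw [h2] at h1
  rcases (norm_nonneg (J (x * u))).eq_or_lt with h3 | h3
  · rw [← h3]; positivity
  · refine le_of_mul_le_mul_left (h1.trans (le_of_eq ?_)) h3
    ring

end IsReducedFreeProduct

theorem norm_le_norm_sqrt_sq {T : H →L[ℂ] H} (hT : 0 ≤ T) : ‖T‖ ≤ ‖CFC.sqrt T‖ ^ 2 := by
  conv_lhs => rw [← CFC.sqrt_mul_sqrt_self T hT]
  rw [sq]
  exact norm_mul_le _ _

theorem squareFunctionNorm_nonneg (n : ℕ) (y : ℕ → (H →L[ℂ] H)) : 0 ≤ squareFunctionNorm n y :=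
  (norm_nonneg _).trans (le_max_left _ _)

theorem norm_sum_star_mul_self_le {n : ℕ} {s : Finset ℕ} (hs : s ⊆ Finset.range n)
    (y : ℕ → (H →L[ℂ] H)) : ‖∑ k ∈ s, star (y k) * y k‖ ≤ squareFunctionNorm n y ^ 2 := by
  have h0 : ∀ t : Finset ℕ, 0 ≤ ∑ k ∈ t, star (y k) * y k := fun t =>
    Finset.sum_nonneg fun i _ => star_mul_self_nonneg _
  refine (CStarAlgebra.norm_le_norm_of_nonneg_of_le (h0 s) (Finset.sum_le_sum_of_subset_of_nonneg hs
    fun i _ _ => star_mul_self_nonneg _)).trans ((norm_le_norm_sqrt_sq (h0 _)).trans ?_)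
  exact pow_le_pow_left₀ (norm_nonneg _) (le_max_right _ _) 2

theorem norm_sum_mul_star_self_le {n : ℕ} {s : Finset ℕ} (hs : s ⊆ Finset.range n)
    (y : ℕ → (H →L[ℂ] H)) : ‖∑ k ∈ s, y k * star (y k)‖ ≤ squareFunctionNorm n y ^ 2 := by
  have h0 : ∀ t : Finset ℕ, 0 ≤ ∑ k ∈ t, y k * star (y k) := fun t =>
    Finset.sum_nonneg fun i _ => mul_star_self_nonneg _
  refine (CStarAlgebra.norm_le_norm_of_nonneg_of_le (h0 s) (Finset.sum_le_sum_of_subset_of_nonneg hs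
    fun i _ _ => mul_star_self_nonneg _)).trans ((norm_le_norm_sqrt_sq (h0 _)).trans ?_)
  exact pow_le_pow_left₀ (norm_nonneg _) (le_max_left _ _) 2

/-- The constant obtained is `1 + 2 √d + d`. -/
theorem norm_sum_martingaleDiff_le (hF : IsReducedFreeProduct M N A E) {d : ℕ}
    {x : ℕ → M.toStarSubalgebra} (hx : IsFreeMartingale A E x)
    (hd : ∀ k, martingaleDiff x k ∈ freePoly A E d) (n : ℕ) :
    ‖∑ k ∈ Finset.range n, (martingaleDiff x k : H →L[ℂ] H)‖ ≤
      (1 + (2 * √d + d)) * squareFunctionNorm n (fun k => (martingaleDiff x k : H →L[ℂ] H)) := by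
  set R := squareFunctionNorm n (fun k => (martingaleDiff x k : H →L[ℂ] H)) with hRdef
  have hR : 0 ≤ R := squareFunctionNorm_nonneg _ _
  cases n with
  | zero => simp only [Finset.range_zero, Finset.sum_empty, norm_zero]; positivity
  | succ m =>
    have hsub : (Finset.range (m + 1)).erase 0 ⊆ Finset.range (m + 1) := Finset.erase_subset _ _
    have h0 : (0 : ℕ) ∈ Finset.range (m + 1) := by simp
    -- The term `k = 0` is separated, as it need not consist of words containing the index `0`; its
    -- norm alone is at most `R`.
    rw [← Finset.add_sum_erase _ _ h0, add_mul, one_mul]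
    refine (norm_add_le _ _).trans (add_le_add ?_ ?_)
    · have h1 := norm_sum_star_mul_self_le (s := {0}) (Finset.singleton_subset_iff.2 h0)
        (fun k => (martingaleDiff x k : H →L[ℂ] H))
      rw [Finset.sum_singleton, CStarRing.norm_star_mul_self, ← sq] at h1
      exact le_of_sq_le_sq h1 hR
    · refine hF.norm_sum_le _ (fun k hk => ?_) hR (norm_sum_star_mul_self_le hsub _)
        (norm_sum_mul_star_self_le hsub _)
      obtain ⟨j, rfl⟩ := Nat.exists_eq_succ_of_ne_zero (Finset.ne_of_mem_erase hk)
      exact hF.martingaleDiff_succ_mem hx hd j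

theorem one_add_two_mul_sqrt_add_le {d : ℕ} (hd : 1 ≤ d) :
    1 + (2 * √(d : ℝ) + d) ≤ 4 ^ d * (d : ℝ) ^ 2 * √(d.factorial : ℝ) := by
  have h1 : (1 : ℝ) ≤ d := by exact_mod_cast hd
  have h2 : √(d : ℝ) ≤ d := Real.sqrt_le_iff.2 ⟨by linarith, by nlinarith⟩
  have h3 : (4 : ℝ) ≤ 4 ^ d := le_self_pow₀ (by norm_num) (by omega)
  have h4 : (1 : ℝ) ≤ √(d.factorial : ℝ) :=
    Real.one_le_sqrt.2 (by exact_mod_cast d.factorial_pos)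
  have h5 : (d : ℝ) ≤ (d : ℝ) ^ 2 := by nlinarith
  calc 1 + (2 * √(d : ℝ) + d) ≤ 4 * (d : ℝ) * 1 := by linarith
    _ ≤ 4 ^ d * (d : ℝ) ^ 2 * √(d.factorial : ℝ) := by gcongr

end SquareFunction

theorem mainTheorem9 :
    ∃ c : ℝ, 0 < c ∧
      ∀ (H : Type u) [NormedAddCommGroup H] [InnerProductSpace ℂ H] [CompleteSpace H]
        (M N : VonNeumannAlgebra H) (A : ℕ → VonNeumannAlgebra H)
        (E : M.toStarSubalgebra →ₗ[ℂ] N.toStarSubalgebra),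
        IsReducedFreeProduct M N A E →
        ∀ (d : ℕ), 1 ≤ d →
        ∀ x : ℕ → M.toStarSubalgebra, IsFreeMartingale A E x →
          (∀ k, martingaleDiff x k ∈ freePoly A E d) →
          ∀ n : ℕ,
            ‖∑ k ∈ Finset.range n, (martingaleDiff x k : H →L[ℂ] H)‖ ≤
              c ^ d * (d : ℝ) ^ 2 * Real.sqrt (Nat.factorial d : ℝ) *
                squareFunctionNorm n (fun k => (martingaleDiff x k : H →L[ℂ] H)) := by
  -- From `√d ≤ d` and `1 ≤ d` one gets `1 + 2√d + d ≤ 4 d`, which the factor `4 ^ d` absorbs for `d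
  -- ≥ 1`.
  refine ⟨4, by norm_num, ?_⟩
  intro H _ _ _ M N A E hF d hd x hx hpoly n
  exact (norm_sum_martingaleDiff_le hF hx hpoly n).trans
    (mul_le_mul_of_nonneg_right (one_add_two_mul_sqrt_add_le hd) (squareFunctionNorm_nonneg _ _))
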